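/- All graphs are finite, simple, undirected and have a non-empty vertex set. A \emph{galled-tree} on $X$ is a finite directed acyclic graph $N=(V,E)$ with $X\subseteq V$ such that either $V=X=\{x\}$, or the following hold: (N1) there is a unique root $\rho_N$, i.e. a unique vertex of indegree $0$, and it has outdegree at least $2$; (N2) $x\in X$ if and only if $x$ has outdegree $0$ and indegree $1$; (N3) every vertex $v\in V\setminus X$ with $v\ne\rho_N$ has either indegree $1$ and outdegree at least $2$, or indegree $2$ and outdegree at least $1$ (in the latter case $v$ is a \emph{hybrid-vertex}); (N4) each biconnected component $C$ of (the underlying undirected graph of) $N$ contains at most one hybrid-vertex $v$ for which both vertices $v_1,v_2$ with $(v_1,v),(v_2,v)\in E$ belong to $C$. A \emph{labeling} of $N$ is a map $t\colon V\to\{0,1,\odot\}$ with $t(x)=\odot$ if and only if $x\in X$. For leaves $x,y\in X$, the \emph{lowest common ancestor} $\operatorname{lca}_N(x,y)$ is the (in a galled-tree unique) vertex $u$ from which both $x$ and $y$ can be reached by directed paths and which is minimal with this property, i.e. no other such vertex can be reached from $u$. A graph $G$ is \emph{GaTEx} (galled-tree explainable) if there is a galled-tree $N$ on some set $X$ with a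 labeling $t$ such that $G$ is isomorphic to the graph with vertex set $X$ in which distinct $x,y$ are adjacent precisely if $t(\operatorname{lca}_N(x,y))=1$. A \emph{module} of a graph $G=(V,E)$ is a non-empty set $M\subseteq V$ such that $N_G(x)\setminus M=N_G(y)\setminus M$ for all $x,y\in M$. The graph $G$ is \emph{primitive} if $|V|\ge 4$ and its only modules are $V$ and the singletons. \emph{Cographs} are defined recursively: the single-vertex graph is a cograph, and the disjoint union and the join of two vertex-disjoint cographs are cographs. A graph $G$ is a \emph{pseudo-cograph} if $|V(G)|\le 2$ or there are induced subgraphs $G_1,G_2$ of $G$ and a vertex $v\in V(G)$ such that (P1) $V(G)=V(G_1)\cup V(G_2)$, $V(G_1)\cap V(G_2)=\{v\}$, $|V(G_1)|>1$ and $|V(G_2)|>1$; (P2) $G_1$ and $G_2$ are cographs; (P3) $G-v$ is either the join or the disjoint union of $G_1-v$ and $G_2-v$. \textbf{Theorem.} A graph $G$ is GaTEx if and only if every primitive induced subgraph of $G$ is a pseudo-cograph. -/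

import Mathlib

namespace Gatex

universe u

section Undirected

variable {V : Type u}

/-- `M` is a module of `G`: all vertices of `M` have the same neighbours outside `M`. -/
def IsModule (G : SimpleGraph V) (M : Set V) : Prop :=
  ∀ x ∈ M, ∀ y ∈ M, G.neighborSet x \ M = G.neighborSet y \ M

/-- `G` is primitive: it has at least four vertices, and each of its (non-empty) modules is
trivial, that is, a singleton or the whole vertex set. -/
def IsPrimitive (G : SimpleGraph V) : Prop :=
  4 ≤ Nat.card V ∧
    ∀ M : Set V, M.Nonempty → IsModule G M → (∃ x, M = {x}) ∨ M = Set.univ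

/-- `InducesCograph G A` says that the induced subgraph `G[A]` is a cograph. Cographs are the
graphs obtained from single vertices by repeatedly taking disjoint unions and joins of
vertex-disjoint cographs. -/
inductive InducesCograph (G : SimpleGraph V) : Set V → Prop
  | single (v : V) : InducesCograph G {v}
  | union (A B : Set V) (hA : InducesCograph G A) (hB : InducesCograph G B)
      (hdisj : Disjoint A B) (h : ∀ a ∈ A, ∀ b ∈ B, ¬ G.Adj a b) : InducesCograph G (A ∪ B)
  | join (A B : Set V) (hA : InducesCograph G A) (hB : InducesCograph G B)
      (hdisj : Disjoint A B) (h : ∀ a ∈ A, ∀ b ∈ B, G.Adj a b) : InducesCograph G (A ∪ B)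

/-- `G` is a `(v, G[Y], G[Z])`-pseudo-cograph. -/
structure IsPseudoCographFor (G : SimpleGraph V) (v : V) (Y Z : Set V) : Prop where
  union_eq : Y ∪ Z = Set.univ
  inter_eq : Y ∩ Z = {v}
  one_lt_left : 1 < Y.ncard
  one_lt_right : 1 < Z.ncard
  cograph_left : InducesCograph G Y
  cograph_right : InducesCograph G Z
  /-- `G - v` is the join or the disjoint union of `G[Y] - v` and `G[Z] - v`. -/
  join_or_union : (∀ y ∈ Y \ {v}, ∀ z ∈ Z \ {v}, G.Adj y z) ∨
    (∀ y ∈ Y \ {v}, ∀ z ∈ Z \ {v}, ¬ G.Adj y z)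

/-- `G` is a pseudo-cograph. -/
def IsPseudoCograph (G : SimpleGraph V) : Prop :=
  Nat.card V ≤ 2 ∨ ∃ (v : V) (Y Z : Set V), IsPseudoCographFor G v Y Z

/-- A graph is biconnected if it is connected and no removal of a vertex disconnects it. Single
vertices and single edges are biconnected. -/
def IsBiconnected (G : SimpleGraph V) : Prop :=
  G.Connected ∧ ∀ v : V, (G.induce {v}ᶜ).Preconnected

/-- `C` is the vertex set of a biconnected component (a maximal biconnected subgraph) of `G`.
Such subgraphs are induced, so that maximality can be expressed with vertex sets. -/
def IsBiconnectedComponent (G : SimpleGraph V) (C : Set V) : Prop :=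
  Maximal (fun B : Set V => IsBiconnected (G.induce B)) C

end Undirected

section Directed

variable {W : Type u}

/-- The indegree of a vertex of a (finite) directed graph. -/
noncomputable def indeg (N : Digraph W) (v : W) : ℕ := {u | N.Adj u v}.ncard

/-- The outdegree of a vertex of a (finite) directed graph. -/
noncomputable def outdeg (N : Digraph W) (v : W) : ℕ := {w | N.Adj v w}.ncard

/-- A vertex with indegree 2 and outdegree at least 1. -/
def IsHybrid (N : Digraph W) (v : W) : Prop := indeg N v = 2 ∧ 1 ≤ outdeg N v

/-- A vertex with indegree 1 and outdegree at least 2. -/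
def IsTreeVertex (N : Digraph W) (v : W) : Prop := indeg N v = 1 ∧ 2 ≤ outdeg N v

/-- The underlying undirected graph of a directed graph. -/
def underlying (N : Digraph W) : SimpleGraph W := SimpleGraph.fromRel N.Adj

/-- `N` has a unique root, that is, a unique vertex of indegree 0, and this root has outdegree at
least 2; the elements of `X` are exactly the vertices of outdegree 0 and indegree 1; all other
vertices are tree-vertices or hybrid-vertices; and each biconnected component contains at most
one hybrid-vertex both of whose parents lie in that component. -/
def IsNontrivialNetwork (N : Digraph W) (X : Set W) : Prop :=
  ∃ ρ : W,
    (indeg N ρ = 0 ∧ 2 ≤ outdeg N ρ ∧ ∀ v, indeg N v = 0 → v = ρ) ∧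
    (∀ x, x ∈ X ↔ outdeg N x = 0 ∧ indeg N x = 1) ∧
    (∀ v, v ∉ X → v ≠ ρ → IsTreeVertex N v ∨ IsHybrid N v) ∧
    (∀ C, IsBiconnectedComponent (underlying N) C →
      {h | h ∈ C ∧ IsHybrid N h ∧ ∀ u, N.Adj u h → u ∈ C}.Subsingleton)

/-- `N` is a galled-tree with leaf set `X`: a finite directed acyclic graph which is a single
vertex or satisfies the network conditions above. -/
structure IsGalledTree (N : Digraph W) (X : Set W) : Prop where
  finite : Finite W
  acyclic : ∀ v, ¬ Relation.TransGen N.Adj v v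
  shape : (∃ x : W, (Set.univ : Set W) = {x} ∧ X = {x}) ∨ IsNontrivialNetwork N X

/-- The possible labels of the vertices of a galled-tree: `0`, `1` and `⊙`. -/
inductive Label
  | zero
  | one
  | leaf

/-- A labeling gives the label `⊙` to the leaves and a binary label to all other vertices. -/
def IsLabeling (X : Set W) (t : W → Label) : Prop := ∀ v, t v = Label.leaf ↔ v ∈ X

/-- `u` is an ancestor of `v`: there is a directed path, possibly of length 0, from `u` to `v`. -/
def IsAncestor (N : Digraph W) (u v : W) : Prop := Relation.ReflTransGen N.Adj u v

/-- `u` is a lowest common ancestor of `A`: a common ancestor of `A` such that no other common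
ancestor of `A` is a descendant of `u`. -/
def IsLCA (N : Digraph W) (A : Set W) (u : W) : Prop :=
  (∀ a ∈ A, IsAncestor N u a) ∧
    ∀ w, (∀ a ∈ A, IsAncestor N w a) → IsAncestor N u w → w = u

/-- The graph on the leaf set `X` that is explained by `(N, t)`: distinct leaves `x` and `y` are
adjacent precisely if their lowest common ancestor has label `1`. (In a galled-tree, two leaves
have exactly one lowest common ancestor.) -/
def explainedGraph (N : Digraph W) (X : Set W) (t : W → Label) : SimpleGraph X where
  Adj x y := x ≠ y ∧ ∃ u : W, IsLCA N {(x : W), (y : W)} u ∧ t u = Label.one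
  symm := ⟨fun x y h => ⟨h.1.symm, by rw [Set.pair_comm]; exact h.2⟩⟩
  loopless := ⟨fun _ h => h.1 rfl⟩

end Directed

/-- `G` is galled-tree explainable: it is isomorphic to the graph explained by some labeled
galled-tree. (Galled-trees are finite, so vertex types in the lowest universe suffice.) -/
def IsGaTEx {V : Type u} (G : SimpleGraph V) : Prop :=
  ∃ (W : Type) (N : Digraph W) (X : Set W) (t : W → Label),
    IsGalledTree N X ∧ IsLabeling X t ∧ Nonempty (G ≃g explainedGraph N X t)

end Gatex

/-!
A galled-tree is analysed through its *clusters*, the sets of leaves below its vertices, and the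
two implications are proved separately.

**Explainable graphs.** If two incomparable vertices `u` and `v` have a common descendant, then
they `Meets` in a hybrid-vertex `h`. The paths from a minimal common ancestor of `u` and `v` to `h`
form a biconnected set (`IsGalled.exists_between_of_meets`), and unions of biconnected sets with two
common vertices are biconnected. Since a biconnected set contains at most one hybrid-vertex together
with its parents, `h` depends on `u` alone (`Meets.eq`). Hence the common descendants of `u` and
`v` are the descendants of `h`, any two vertices have a least common ancestor, all clusters that
overlap a given cluster have the same intersection with it, and no three clusters overlap pairwise,
as `h` has just two parents. These properties are collected in `IsClusterSystem`. They do not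
require that all leaves are vertices of the explained graph, so they hold for induced subgraphs as
well. In a graph with such a system, intersections of overlapping clusters and unions of maximal
pairs of overlapping clusters are modules. If the graph is primitive, it therefore has two clusters
that cover it and meet in a single vertex. The traces of the clusters on each of the two form a hierarchy, so
that both induce cographs (`IsClusterSystem.isPseudoCograph`).

**Graphs with primitive induced pseudo-cographs.** By induction on the number of vertices, it
suffices to treat two cases. If the graph has a nontrivial module `M`, then a network for `G[M]` is
substituted for the leaf `m ∈ M` in a network for the graph in which `M` is shrunk to `m`
(`isGaTEx_of_isModule`). The root of the inserted network is a cut vertex, whence no biconnected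
component grows. Otherwise the graph has at most two vertices or is primitive, thus a
pseudo-cograph with parts `Y` and `Z` that share `v`. In its cograph `G[Y]` every subgraph hanging
off the path from the root of the cotree to `v` is a module and therefore a single vertex. So `Y`
can be ordered such that each vertex is adjacent to all or to none of the vertices between it and
`v`, and likewise `Z`. The two orders are the two sides of a network with a single cycle, whose
hybrid-vertex is the parent of `v` (`IsPseudoCographFor.isGaTEx`).
-/

namespace Gatex

universe u

/-! ### Cluster systems -/

section Clusters

variable {V : Type u}

/-- Two sets overlap if they meet and neither contains the other. -/
def Overlap (A B : Set V) : Prop := (A ∩ B).Nonempty ∧ ¬ A ⊆ B ∧ ¬ B ⊆ A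

theorem Overlap.symm {A B : Set V} (h : Overlap A B) : Overlap B A :=
  ⟨by rw [Set.inter_comm]; exact h.1, h.2.2, h.2.1⟩

/-- A set that leaves `E` while meeting it either contains `E` or overlaps it. -/
theorem subset_or_overlap {E C : Set V} {x z : V} (hx : x ∈ E) (hxC : x ∈ C) (hz : z ∈ C)
    (hzE : z ∉ E) : E ⊆ C ∨ Overlap E C := by
  by_cases h : E ⊆ C
  · exact Or.inl h
  · exact Or.inr ⟨⟨x, hx, hxC⟩, h, fun h' => hzE (h' hz)⟩

/-- A cluster system `𝓒` that explains `G` in the way the leaf sets below the vertices of a labeled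
galled-tree do: any two vertices `x`, `y` lie in a smallest cluster `c x y`, this cluster
determines whether they are adjacent, all clusters that overlap a given one cut out the same part
of it, and no three clusters overlap pairwise. -/
structure IsClusterSystem (G : SimpleGraph V) (𝓒 : Set (Set V)) (c : V → V → Set V) : Prop where
  mem : ∀ x y, c x y ∈ 𝓒
  left_mem : ∀ x y, x ∈ c x y
  right_mem : ∀ x y, y ∈ c x y
  subset : ∀ C ∈ 𝓒, ∀ x ∈ C, ∀ y ∈ C, c x y ⊆ C
  adj_iff : ∀ x y x' y', x ≠ y → x' ≠ y' → c x y = c x' y' → (G.Adj x y ↔ G.Adj x' y')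
  inter_eq : ∀ C₁ ∈ 𝓒, ∀ C₂ ∈ 𝓒, ∀ C₃ ∈ 𝓒, Overlap C₁ C₂ → Overlap C₁ C₃ → C₁ ∩ C₂ = C₁ ∩ C₃
  not_three : ∀ C₁ ∈ 𝓒, ∀ C₂ ∈ 𝓒, ∀ C₃ ∈ 𝓒, Overlap C₁ C₂ → Overlap C₁ C₃ → ¬ Overlap C₂ C₃

theorem isModule_of_adj {G : SimpleGraph V} {M : Set V}
    (h : ∀ x ∈ M, ∀ y ∈ M, ∀ z ∉ M, G.Adj x z → G.Adj y z) : IsModule G M := by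
  intro x hx y hy
  ext z
  simp only [Set.mem_sdiff, SimpleGraph.mem_neighborSet]
  exact ⟨fun ⟨h1, h2⟩ => ⟨h x hx y hy z h2 h1, h2⟩, fun ⟨h1, h2⟩ => ⟨h y hy x hx z h2 h1, h2⟩⟩

theorem IsModule.adj_iff {G : SimpleGraph V} {M : Set V} (h : IsModule G M) {x y z : V}
    (hx : x ∈ M) (hy : y ∈ M) (hz : z ∉ M) : G.Adj x z ↔ G.Adj y z := by
  have := Set.ext_iff.1 (h x hx y hy) z
  simpa [hz] using this

variable {G : SimpleGraph V} {𝓒 : Set (Set V)} {c : V → V → Set V}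

namespace IsClusterSystem

theorem isModule (hS : IsClusterSystem G 𝓒 c) {M : Set V}
    (h : ∀ x ∈ M, ∀ y ∈ M, ∀ z ∉ M, y ∈ c x z) : IsModule G M := by
  refine isModule_of_adj fun x hx y hy z hz => ?_
  have h1 : ∀ x ∈ M, ∀ y ∈ M, c y z ⊆ c x z := fun x hx y hy =>
    hS.subset _ (hS.mem x z) y (h x hx y hy z hz) z (hS.right_mem x z)
  have hne : ∀ x ∈ M, x ≠ z := fun x hx e => hz (e ▸ hx)
  exact (hS.adj_iff x z y z (hne x hx) (hne y hy)
    ((h1 y hy x hx).antisymm (h1 x hx y hy))).1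

/-- A cluster that joins a vertex of `E` to a vertex outside `E` contains the common part of `E`
and the clusters overlapping `E`. -/
theorem inter_subset (hS : IsClusterSystem G 𝓒 c) {E F : Set V} (hE : E ∈ 𝓒) (hF : F ∈ 𝓒)
    (ho : Overlap E F) {x z : V} (hx : x ∈ E) (hz : z ∉ E) : E ∩ F ⊆ c x z := by
  rcases subset_or_overlap hx (hS.left_mem x z) (hS.right_mem x z) hz with h | h
  · exact Set.inter_subset_left.trans h
  · rw [hS.inter_eq E hE F hF _ (hS.mem x z) ho h]
    exact Set.inter_subset_right

theorem isModule_inter (hS : IsClusterSystem G 𝓒 c) {E F : Set V} (hE : E ∈ 𝓒) (hF : F ∈ 𝓒)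
    (ho : Overlap E F) : IsModule G (E ∩ F) := by
  refine hS.isModule fun x hx y hy z hz => ?_
  by_cases hzE : z ∈ E
  · have hzF : z ∉ F := fun h => hz ⟨hzE, h⟩
    exact hS.inter_subset hF hE ho.symm hx.2 hzF ⟨hy.2, hy.1⟩
  · exact hS.inter_subset hE hF ho hx.1 hzE hy

/-- The union of an inclusion-maximal pair of overlapping clusters is a module. -/
theorem exists_isModule_union [Finite V] (hS : IsClusterSystem G 𝓒 c) {E₀ F₀ : Set V}
    (hE₀ : E₀ ∈ 𝓒) (hF₀ : F₀ ∈ 𝓒) (ho : Overlap E₀ F₀) :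
    ∃ E ∈ 𝓒, ∃ F ∈ 𝓒, E₀ ⊆ E ∧ F₀ ⊆ F ∧ Overlap E F ∧ IsModule G (E ∪ F) := by
  obtain ⟨⟨E, F⟩, hle, hmax⟩ := Set.Finite.exists_le_maximal
    (Set.toFinite {p : Set V × Set V | p.1 ∈ 𝓒 ∧ p.2 ∈ 𝓒 ∧ Overlap p.1 p.2})
    (show (E₀, F₀) ∈ _ from ⟨hE₀, hF₀, ho⟩)
  obtain ⟨hE, hF, hEF⟩ := hmax.prop
  simp only at hE hF hEF
  refine ⟨E, hE, F, hF, hle.1, hle.2, hEF, ?_⟩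
  obtain ⟨v, hvE, hvF⟩ := hEF.1
  have key : ∀ z ∉ E ∪ F, E ∪ F ⊆ c v z := by
    intro z hz
    have hzE : z ∉ E := fun h => hz (Or.inl h)
    have hzF : z ∉ F := fun h => hz (Or.inr h)
    have hm := hS.mem v z
    rcases subset_or_overlap hvE (hS.left_mem v z) (hS.right_mem v z) hzE with h1 | h1 <;>
    rcases subset_or_overlap hvF (hS.left_mem v z) (hS.right_mem v z) hzF with h2 | h2
    · exact Set.union_subset h1 h2
    · have := hmax.le_of_ge (y := (c v z, F)) ⟨hm, hF, h2.symm⟩ ⟨h1, le_rfl⟩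
      exact absurd (this.1 (hS.right_mem v z)) hzE
    · have := hmax.le_of_ge (y := (E, c v z)) ⟨hE, hm, h1⟩ ⟨le_rfl, h2⟩
      exact absurd (this.2 (hS.right_mem v z)) hzF
    · exact absurd h2 (hS.not_three E hE F hF _ hm hEF h1)
  refine hS.isModule fun x hx y hy z hz => ?_
  have hzE : z ∉ E := fun h => hz (Or.inl h)
  have hzF : z ∉ F := fun h => hz (Or.inr h)
  have hv : v ∈ c x z := by
    rcases hx with hx | hx
    · exact hS.inter_subset hE hF hEF hx hzE ⟨hvE, hvF⟩
    · exact hS.inter_subset hF hE hEF.symm hx hzF ⟨hvF, hvE⟩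
  exact hS.subset _ (hS.mem x z) v hv z (hS.right_mem x z) (key z hz hy)

/-- If the traces of the clusters on `S` form a hierarchy, then `G[S]` is a cograph. -/
theorem inducesCograph [Finite V] (hS : IsClusterSystem G 𝓒 c) (n : ℕ) :
    ∀ S : Set V, S.ncard = n → S.Nonempty →
      (∀ E ∈ 𝓒, ∀ F ∈ 𝓒, ¬ Overlap (E ∩ S) (F ∩ S)) → InducesCograph G S := by
  induction n using Nat.strong_induction_on with
  | _ n ih =>
  rintro S rfl ⟨x, hx⟩ hov
  by_cases hsub : S = {x}
  · rw [hsub]; exact .single x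
  -- `T` is a maximal proper trace containing `x`, or `{x}` if there is none
  obtain ⟨T, hxT, hTS, hTmax, hTov⟩ : ∃ T : Set V, x ∈ T ∧ T ⊂ S ∧
      (∀ E ∈ 𝓒, T ⊆ E → E ∩ S ⊂ S → E ∩ S ⊆ T) ∧ ∀ E ∈ 𝓒, ¬ Overlap T (E ∩ S) := by
    by_cases hne : ∃ E ∈ 𝓒, x ∈ E ∧ E ∩ S ⊂ S
    · obtain ⟨E₀, hE₀, hxE₀, hlt⟩ := hne
      obtain ⟨T, -, hmax⟩ := Set.Finite.exists_le_maximal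
        (Set.toFinite {T : Set V | ∃ E ∈ 𝓒, x ∈ E ∧ E ∩ S ⊂ S ∧ T = E ∩ S})
        (show E₀ ∩ S ∈ _ from ⟨E₀, hE₀, hxE₀, hlt, rfl⟩)
      obtain ⟨E, hE, hxE, hlt, rfl⟩ := hmax.prop
      refine ⟨E ∩ S, ⟨hxE, hx⟩, hlt, fun F hF hEF hFS => ?_, fun F hF => hov E hE F hF⟩
      exact hmax.le_of_ge ⟨F, hF, hEF ⟨hxE, hx⟩, hFS, rfl⟩
        (Set.subset_inter hEF Set.inter_subset_right)
    · refine ⟨{x}, rfl, ⟨by simpa using hx, fun h => hsub (h.antisymm (by simpa using hx))⟩,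
        fun E hE hxE hES => absurd ⟨E, hE, by simpa using hxE, hES⟩ hne, ?_⟩
      rintro E hE ⟨⟨w, hw, hwE⟩, h1, -⟩
      obtain rfl : w = x := hw
      exact h1 (by simpa using hwE)
  have hdiff : (S \ T).Nonempty := Set.nonempty_of_ssubset hTS
  have hsubov : ∀ R ⊆ S, ∀ E ∈ 𝓒, ∀ F ∈ 𝓒, ¬ Overlap (E ∩ R) (F ∩ R) := by
    rintro R hR E hE F hF ⟨⟨w, hw, hw'⟩, h1, h2⟩
    refine hov E hE F hF ⟨⟨w, ⟨hw.1, hR hw.2⟩, ⟨hw'.1, hR hw.2⟩⟩, fun h => h1 ?_, fun h => h2 ?_⟩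
    · exact fun a ha => ⟨(h ⟨ha.1, hR ha.2⟩).1, ha.2⟩
    · exact fun a ha => ⟨(h ⟨ha.1, hR ha.2⟩).1, ha.2⟩
  have hT : InducesCograph G T :=
    ih _ (Set.ncard_lt_ncard hTS) T rfl ⟨x, hxT⟩ (hsubov T hTS.subset)
  have hST : InducesCograph G (S \ T) :=
    ih _ (Set.ncard_lt_ncard ⟨Set.sdiff_subset, fun h => (h hx).2 hxT⟩) _ rfl hdiff
      (hsubov _ Set.sdiff_subset)
  -- every cluster joining `T` to `S \ T` contains `S`
  have hbig : ∀ a ∈ T, ∀ b ∈ S \ T, S ⊆ c a b := by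
    intro a ha b hb
    have hbc : b ∈ c a b ∩ S := ⟨hS.right_mem a b, hb.1⟩
    have hTc : T ⊆ c a b ∩ S := by
      by_contra hcon
      exact hTov _ (hS.mem a b) ⟨⟨a, ha, hS.left_mem a b, hTS.subset ha⟩, hcon,
        fun h => hb.2 (h hbc)⟩
    by_contra hcon
    exact hb.2 (hTmax _ (hS.mem a b) (hTc.trans Set.inter_subset_left)
      ⟨Set.inter_subset_right, fun h => hcon (h.trans Set.inter_subset_left)⟩ hbc)
  have hconst : ∀ a ∈ T, ∀ b ∈ S \ T, ∀ a' ∈ T, ∀ b' ∈ S \ T, (G.Adj a b ↔ G.Adj a' b') := by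
    have hle : ∀ a ∈ T, ∀ b ∈ S \ T, ∀ a' ∈ T, ∀ b' ∈ S \ T, c a b ⊆ c a' b' :=
      fun a ha b hb a' ha' b' hb' => hS.subset _ (hS.mem a' b') a
        (hbig a' ha' b' hb' (hTS.subset ha)) b (hbig a' ha' b' hb' hb.1)
    intro a ha b hb a' ha' b' hb'
    exact hS.adj_iff _ _ _ _ (fun e => hb.2 (e ▸ ha)) (fun e => hb'.2 (e ▸ ha'))
      ((hle a ha b hb a' ha' b' hb').antisymm (hle a' ha' b' hb' a ha b hb))
  rw [← Set.union_sdiff_cancel hTS.subset]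
  obtain ⟨b₀, hb₀⟩ := hdiff
  by_cases hadj : G.Adj x b₀
  · exact .join T _ hT hST Set.disjoint_sdiff_right
      fun a ha b hb => (hconst a ha b hb x hxT b₀ hb₀).2 hadj
  · exact .union T _ hT hST Set.disjoint_sdiff_right
      fun a ha b hb h => hadj ((hconst a ha b hb x hxT b₀ hb₀).1 h)

/-- A primitive graph that is explained by a cluster system is a pseudo-cograph: two clusters
cover it and meet in a single vertex. -/
theorem isPseudoCograph [Finite V] (hS : IsClusterSystem G 𝓒 c) (hG : IsPrimitive G) :
    IsPseudoCograph G := by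
  obtain ⟨hcard, hprim⟩ := hG
  -- overlapping clusters meet in a single vertex
  have hsingle : ∀ E ∈ 𝓒, ∀ F ∈ 𝓒, Overlap E F → ∃ v, E ∩ F = {v} := by
    intro E hE F hF ho
    refine (hprim _ ho.1 (hS.isModule_inter hE hF ho)).resolve_right fun h => ho.2.1 ?_
    exact fun a _ => (h.symm.subset (Set.mem_univ a)).2
  -- overlapping clusters extend to overlapping clusters that cover everything
  have hcover : ∀ E₀ ∈ 𝓒, ∀ F₀ ∈ 𝓒, Overlap E₀ F₀ → ∃ E ∈ 𝓒, ∃ F ∈ 𝓒, E₀ ⊆ E ∧ F₀ ⊆ F ∧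
      Overlap E F ∧ E ∪ F = Set.univ := by
    intro E₀ hE₀ F₀ hF₀ ho
    obtain ⟨E, hE, F, hF, h1, h2, h3, h4⟩ := hS.exists_isModule_union hE₀ hF₀ ho
    refine ⟨E, hE, F, hF, h1, h2, h3, (hprim _ ?_ h4).resolve_left ?_⟩
    · obtain ⟨v, hv, -⟩ := h3.1
      exact ⟨v, Or.inl hv⟩
    · rintro ⟨x, hx⟩
      obtain ⟨v, hv, hv'⟩ := h3.1
      refine h3.2.1 fun a ha => ?_
      have ea : a = x := hx.subset (Or.inl ha)
      have ev : v = x := hx.subset (Or.inl hv)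
      rw [ea, ← ev]; exact hv'
  by_cases hex : ∃ E ∈ 𝓒, ∃ F ∈ 𝓒, Overlap E F
  swap
  · -- without overlapping clusters the graph would be complete or edgeless
    exfalso
    have huniv : ∀ x y, x ≠ y → c x y = Set.univ := by
      intro x y hxy
      refine (hprim _ ⟨x, hS.left_mem x y⟩ (hS.isModule ?_)).resolve_left ?_
      · intro a ha b hb z hz
        rcases subset_or_overlap ha (hS.left_mem a z) (hS.right_mem a z) hz with h | h
        · exact h hb
        · exact absurd ⟨_, hS.mem x y, _, hS.mem a z, h⟩ hex
      · rintro ⟨w, hw⟩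
        have h1 : x = w := hw.subset (hS.left_mem x y)
        have h2 : y = w := hw.subset (hS.right_mem x y)
        exact hxy (h1.trans h2.symm)
    have : Nontrivial V := Finite.one_lt_card_iff_nontrivial.1 (by omega)
    obtain ⟨x, y, hxy⟩ := exists_pair_ne V
    have hmod : IsModule G {x, y} := hS.isModule fun a ha b hb z hz => by
      rw [huniv a z (fun e => hz (e ▸ ha))]; trivial
    rcases hprim _ ⟨x, by simp⟩ hmod with ⟨w, hw⟩ | h
    · have h1 : x = w := hw.subset (by simp)
      have h2 : y = w := hw.subset (by simp)
      exact hxy (h1.trans h2.symm)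
    · have := Set.ncard_pair hxy
      rw [h, Set.ncard_univ] at this
      omega
  obtain ⟨E₀, hE₀, F₀, hF₀, ho₀⟩ := hex
  obtain ⟨Y, hY, Z, hZ, -, -, hYZ, hun⟩ := hcover E₀ hE₀ F₀ hF₀ ho₀
  obtain ⟨v, hv⟩ := hsingle Y hY Z hZ hYZ
  have hcog : ∀ Y ∈ 𝓒, ∀ Z ∈ 𝓒, Overlap Y Z → Y ∪ Z = Set.univ → Y ∩ Z = {v} →
      InducesCograph G Y := by
    intro Y hY Z hZ hYZ hun hv
    have hvY : v ∈ Y := (hv.symm.subset rfl).1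
    have hvZ : v ∈ Z := (hv.symm.subset rfl).2
    refine hS.inducesCograph _ Y rfl ⟨v, hvY⟩ fun E₀ hE₀ F₀ hF₀ ho => ?_
    obtain ⟨⟨w, ⟨hwE, hwY⟩, hwF, -⟩, hn1, hn2⟩ := ho
    have ho : Overlap E₀ F₀ := ⟨⟨w, hwE, hwF⟩,
      fun h => hn1 fun a ha => ⟨h ha.1, ha.2⟩, fun h => hn2 fun a ha => ⟨h ha.1, ha.2⟩⟩
    -- a cluster not containing `Y` that has a trace other than a singleton lies inside `Y`
    have hin : ∀ E ∈ 𝓒, ¬ Y ⊆ E → (∀ u ∈ E ∩ Y, ∃ u' ∈ E ∩ Y, u' ≠ u) → w ∈ E → E ⊆ Y := by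
      intro E hE hYE htr hwE
      by_contra hEY
      have hoE : Overlap Y E := ⟨⟨w, hwY, hwE⟩, hYE, hEY⟩
      have heq := hS.inter_eq Y hY Z hZ E hE hYZ hoE
      rw [hv] at heq
      obtain ⟨u', hu', hne⟩ := htr v ⟨(heq.subset rfl).2, hvY⟩
      exact hne (heq.symm.subset ⟨hu'.2, hu'.1⟩)
    have hEY : E₀ ⊆ Y := by
      refine hin E₀ hE₀ (fun h => hn2 fun a ha => ⟨h ha.2, ha.2⟩) (fun u hu => ?_) hwE
      by_contra hcon
      push Not at hcon
      exact hn1 fun a ha => by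
        rw [hcon a ha, ← hcon w ⟨hwE, hwY⟩]; exact ⟨hwF, hwY⟩
    have hFY : F₀ ⊆ Y := by
      refine hin F₀ hF₀ (fun h => hn1 fun a ha => ⟨h ha.2, ha.2⟩) (fun u hu => ?_) hwF
      by_contra hcon
      push Not at hcon
      exact hn2 fun a ha => by
        rw [hcon a ha, ← hcon w ⟨hwF, hwY⟩]; exact ⟨hwE, hwY⟩
    obtain ⟨E, hE, F, hF, hEE, hFF, hoEF, hunEF⟩ := hcover E₀ hE₀ F₀ hF₀ ho
    obtain ⟨v', hv'⟩ := hsingle E hE F hF hoEF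
    have hw : w = v' := hv'.subset ⟨hEE hwE, hFF hwF⟩
    subst hw
    -- neither extension contains `Y`, as `E₀` and `F₀` are no singletons
    have hYE : ¬ Y ⊆ E := fun h => ho.2.2 fun a ha => by
      rw [show a = w from hv'.subset ⟨h (hFY ha), hFF ha⟩]; exact hwE
    have hYF : ¬ Y ⊆ F := fun h => ho.2.1 fun a ha => by
      rw [show a = w from hv'.subset ⟨hEE ha, h (hEY ha)⟩]; exact hwF
    have hwv : w = v := by
      have aux : ∀ E ∈ 𝓒, ¬ Y ⊆ E → ¬ E ⊆ Y → w ∈ E → w = v := by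
        intro E hE h1 h2 hwE
        have := hS.inter_eq Y hY Z hZ E hE hYZ ⟨⟨w, hwY, hwE⟩, h1, h2⟩
        rw [hv] at this
        exact this.symm.subset ⟨hwY, hwE⟩
      by_cases hE1 : E ⊆ Y
      · by_cases hF1 : F ⊆ Y
        · have : Set.univ ⊆ Y := hunEF ▸ Set.union_subset hE1 hF1
          exact absurd (fun a _ => this (Set.mem_univ a)) hYZ.2.2
        · exact aux F hF hYF hF1 (hFF hwF)
      · exact aux E hE hYE hE1 (hEE hwE)
    subst hwv
    -- now `E₀`, `F₀` and `Z` overlap pairwise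
    refine hS.not_three E₀ hE₀ F₀ hF₀ Z hZ ho ⟨⟨w, hwE, hvZ⟩, fun h => ?_, fun h => ?_⟩
      ⟨⟨w, hwF, hvZ⟩, fun h => ?_, fun h => ?_⟩
    · exact ho.2.1 fun a ha => by
        rw [show a = w from hv.subset ⟨hEY ha, h ha⟩]; exact hwF
    · exact hYZ.2.2 (h.trans hEY)
    · exact ho.2.2 fun a ha => by
        rw [show a = w from hv.subset ⟨hFY ha, h ha⟩]; exact hwE
    · exact hYZ.2.2 (h.trans hFY)
  have hvY : v ∈ Y := (hv.symm.subset rfl).1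
  have hvZ : v ∈ Z := (hv.symm.subset rfl).2
  have hcard : ∀ Y Z : Set V, v ∈ Y → v ∈ Z → ¬ Y ⊆ Z → 1 < Y.ncard := by
    intro Y Z hvY hvZ h
    obtain ⟨a, ha, haZ⟩ := Set.not_subset.1 h
    exact (Set.one_lt_ncard).2 ⟨a, ha, v, hvY, fun e => haZ (e ▸ hvZ)⟩
  have hun' : Z ∪ Y = Set.univ := by rw [Set.union_comm]; exact hun
  have hv2 : Z ∩ Y = {v} := by rw [Set.inter_comm]; exact hv
  refine Or.inr ⟨v, Y, Z, hun, hv, hcard Y Z hvY hvZ hYZ.2.1, hcard Z Y hvZ hvY hYZ.2.2,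
    hcog Y hY Z hZ hYZ hun hv, hcog Z hZ Y hY hYZ.symm hun' hv2, ?_⟩
  -- a cluster joining both sides is the whole vertex set
  have hbig : ∀ y ∈ Y \ {v}, ∀ z ∈ Z \ {v}, c y z = Set.univ := by
    intro y hy z hz
    have aux : ∀ Y ∈ 𝓒, ∀ Z ∈ 𝓒, Overlap Y Z → Y ∩ Z = {v} → ∀ y ∈ Y \ {v}, ∀ z ∉ Y,
        ∀ C ∈ 𝓒, y ∈ C → z ∈ C → Y ⊆ C := by
      intro Y hY Z hZ hYZ hv y hy z hz C hC hyC hzC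
      refine (subset_or_overlap hy.1 hyC hzC hz).resolve_right fun h => ?_
      have := hS.inter_eq Y hY Z hZ C hC hYZ h
      rw [hv] at this
      exact hy.2 (this.symm.subset ⟨hy.1, hyC⟩)
    have hzY : z ∉ Y := fun h => hz.2 (hv.subset ⟨h, hz.1⟩)
    have hyZ : y ∉ Z := fun h => hy.2 (hv.subset ⟨hy.1, h⟩)
    rw [Set.eq_univ_iff_forall]
    intro a
    rcases hun.symm.subset (Set.mem_univ a) with h | h
    · exact aux Y hY Z hZ hYZ hv y hy z hzY _ (hS.mem y z) (hS.left_mem y z)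
        (hS.right_mem y z) h
    · exact aux Z hZ Y hY hYZ.symm hv2 z hz y hyZ _ (hS.mem y z) (hS.right_mem y z)
        (hS.left_mem y z) h
  have hne : ∀ y ∈ Y \ {v}, ∀ z ∈ Z \ {v}, y ≠ z := by
    rintro y hy z hz rfl
    exact hy.2 (hv.subset ⟨hy.1, hz.1⟩)
  by_cases hex : ∃ y ∈ Y \ {v}, ∃ z ∈ Z \ {v}, G.Adj y z
  · obtain ⟨y₀, hy₀, z₀, hz₀, h⟩ := hex
    exact Or.inl fun y hy z hz => (hS.adj_iff _ _ _ _ (hne y hy z hz) (hne y₀ hy₀ z₀ hz₀)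
      ((hbig y hy z hz).trans (hbig y₀ hy₀ z₀ hz₀).symm)).2 h
  · exact Or.inr fun y hy z hz h => hex ⟨y, hy, z, hz, h⟩

end IsClusterSystem

end Clusters

/-! ### Biconnected vertex sets -/

section Biconnected

variable {V : Type u} {G : SimpleGraph V}

/-- `a` and `b` are joined by a walk of `G` inside `S`. -/
def Linked (G : SimpleGraph V) (S : Set V) (a b : V) : Prop :=
  Relation.ReflTransGen (fun x y => G.Adj x y ∧ x ∈ S ∧ y ∈ S) a b

theorem Linked.trans {S : Set V} {a b c : V} (h : Linked G S a b) (h' : Linked G S b c) :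
    Linked G S a c := Relation.ReflTransGen.trans h h'

theorem Linked.symm {S : Set V} {a b : V} (h : Linked G S a b) : Linked G S b a := by
  induction h with
  | refl => exact .refl
  | tail _ h ih => exact Relation.ReflTransGen.head ⟨h.1.symm, h.2.2, h.2.1⟩ ih

theorem Linked.map {V' : Type*} {G' : SimpleGraph V'} {S : Set V} {T : Set V'} (f : V → V')
    (hf : ∀ x ∈ S, ∀ y ∈ S, G.Adj x y → G'.Adj (f x) (f y)) (hT : ∀ x ∈ S, f x ∈ T) {a b : V}
    (h : Linked G S a b) : Linked G' T (f a) (f b) := by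
  induction h with
  | refl => exact .refl
  | @tail x y _ h ih =>
    exact Relation.ReflTransGen.tail ih ⟨hf x h.2.1 y h.2.2 h.1, hT x h.2.1, hT y h.2.2⟩

theorem Linked.mono {S T : Set V} (hST : S ⊆ T) {a b : V} (h : Linked G S a b) :
    Linked G T a b := h.map id (fun _ _ _ _ h => h) hST

/-- The induced subgraph `G[S]` is biconnected, expressed by walks inside subsets of `V`. -/
structure IsBiconnectedSet (G : SimpleGraph V) (S : Set V) : Prop where
  nonempty : S.Nonempty
  linked : ∀ a ∈ S, ∀ b ∈ S, Linked G S a b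
  linked_diff : ∀ s, ∀ a ∈ S \ {s}, ∀ b ∈ S \ {s}, Linked G (S \ {s}) a b

theorem linked_iff_reachable_induce {S : Set V} (a b : S) :
    Linked G S a b ↔ (G.induce S).Reachable a b := by
  rw [SimpleGraph.reachable_iff_reflTransGen]
  constructor
  · obtain ⟨a, ha⟩ := a
    obtain ⟨b, hb⟩ := b
    intro h
    have : ∀ c, Linked G S a c → ∀ hc : c ∈ S,
        Relation.ReflTransGen (G.induce S).Adj ⟨a, ha⟩ ⟨c, hc⟩ := by
      intro c hc
      induction hc with
      | refl => exact fun _ => .refl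
      | tail _ h ih => exact fun hc => (ih h.2.1).tail (by simpa using h.1)
    exact this b h hb
  · intro h
    induction h with
    | refl => exact .refl
    | @tail c d _ h ih => exact Relation.ReflTransGen.tail ih ⟨h, c.2, d.2⟩

theorem isBiconnected_induce_iff {S : Set V} :
    IsBiconnected (G.induce S) ↔ IsBiconnectedSet G S := by
  have key : ∀ s a b : S, ∀ (ha : a ∈ ({s}ᶜ : Set S)) (hb : b ∈ ({s}ᶜ : Set S)),
      ((G.induce S).induce {s}ᶜ).Reachable ⟨a, ha⟩ ⟨b, hb⟩ ↔ Linked G (S \ {(s : V)}) a b := by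
    intro s a b ha hb
    rw [← linked_iff_reachable_induce]
    constructor
    · intro h
      exact h.map (S := {s}ᶜ) (T := S \ {(s : V)}) (fun x : S => (x : V)) (fun _ _ _ _ h => h)
        fun x hx => ⟨x.2, fun e => hx (Subtype.ext e)⟩
    · intro h
      have : ∀ c, Linked G (S \ {(s : V)}) a c → ∀ hc : c ∈ S,
          Linked (G.induce S) {s}ᶜ a ⟨c, hc⟩ := by
        intro c hc
        induction hc with
        | refl => exact fun _ => .refl
        | tail _ h ih =>
          exact fun hc => (ih h.2.1.1).tail ⟨h.1, fun e => h.2.1.2 (congrArg Subtype.val e),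
            fun e => h.2.2.2 (congrArg Subtype.val e)⟩
      exact this b h b.2
  constructor
  · rintro ⟨h1, h2⟩
    have hne : S.Nonempty := Set.nonempty_coe_sort.1 h1.nonempty
    have hl : ∀ a ∈ S, ∀ b ∈ S, Linked G S a b := fun a ha b hb =>
      (linked_iff_reachable_induce ⟨a, ha⟩ ⟨b, hb⟩).2 (h1.preconnected _ _)
    refine ⟨hne, hl, fun s a ha b hb => ?_⟩
    by_cases hs : s ∈ S
    · exact (key ⟨s, hs⟩ ⟨a, ha.1⟩ ⟨b, hb.1⟩ (fun e => ha.2 (congrArg Subtype.val e))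
        (fun e => hb.2 (congrArg Subtype.val e))).1 (h2 ⟨s, hs⟩ _ _)
    · rw [Set.sdiff_singleton_eq_self hs]
      exact hl a ha.1 b hb.1
  · intro h
    refine ⟨?_, fun s => ?_⟩
    · have := h.nonempty.to_subtype
      exact ⟨fun a b => (linked_iff_reachable_induce a b).1 (h.linked a a.2 b b.2)⟩
    · rintro ⟨a, ha⟩ ⟨b, hb⟩
      exact (key s a b ha hb).2 (h.linked_diff s a ⟨a.2, fun e => ha (Subtype.ext e)⟩ b
        ⟨b.2, fun e => hb (Subtype.ext e)⟩)

/-- Two biconnected sets with two common vertices have a biconnected union. -/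
theorem IsBiconnectedSet.union {S T : Set V} (hS : IsBiconnectedSet G S)
    (hT : IsBiconnectedSet G T) {p q : V} (hpq : p ≠ q) (hp : p ∈ S ∩ T) (hq : q ∈ S ∩ T) :
    IsBiconnectedSet G (S ∪ T) := by
  refine ⟨⟨p, Or.inl hp.1⟩, ?_, ?_⟩
  · have : ∀ a ∈ S ∪ T, Linked G (S ∪ T) a p := by
      rintro a (ha | ha)
      · exact (hS.linked a ha p hp.1).mono Set.subset_union_left
      · exact (hT.linked a ha p hp.2).mono Set.subset_union_right
    exact fun a ha b hb => (this a ha).trans (this b hb).symm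
  · intro s
    obtain ⟨r, hr, hrs⟩ : ∃ r ∈ S ∩ T, r ≠ s := by
      by_cases h : p = s
      · exact ⟨q, hq, fun e => hpq (h.trans e.symm)⟩
      · exact ⟨p, hp, h⟩
    have : ∀ a ∈ (S ∪ T) \ {s}, Linked G ((S ∪ T) \ {s}) a r := by
      rintro a ⟨ha | ha, has⟩
      · exact (hS.linked_diff s a ⟨ha, has⟩ r ⟨hr.1, hrs⟩).mono
          (Set.sdiff_subset_sdiff_left Set.subset_union_left)
      · exact (hT.linked_diff s a ⟨ha, has⟩ r ⟨hr.2, hrs⟩).mono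
          (Set.sdiff_subset_sdiff_left Set.subset_union_right)
    exact fun a ha b hb => (this a ha).trans (this b hb).symm

/-- An injective image of a biconnected set under a map that preserves its edges is
biconnected. -/
theorem IsBiconnectedSet.image {V' : Type*} {G' : SimpleGraph V'} {S : Set V}
    (hS : IsBiconnectedSet G S) (f : V → V') (hinj : Set.InjOn f S)
    (hf : ∀ a ∈ S, ∀ b ∈ S, G.Adj a b → G'.Adj (f a) (f b)) : IsBiconnectedSet G' (f '' S) := by
  refine ⟨hS.nonempty.image f, ?_, ?_⟩
  · rintro _ ⟨a, ha, rfl⟩ _ ⟨b, hb, rfl⟩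
    exact (hS.linked a ha b hb).map f hf fun x hx => Set.mem_image_of_mem f hx
  · rintro s _ ⟨⟨a, ha, rfl⟩, has⟩ _ ⟨⟨b, hb, rfl⟩, hbs⟩
    by_cases hs : ∃ s' ∈ S, f s' = s
    · obtain ⟨s', hs', rfl⟩ := hs
      exact (hS.linked_diff s' a ⟨ha, fun e => has (congrArg f e)⟩ b
        ⟨hb, fun e => hbs (congrArg f e)⟩).map (T := f '' S \ {f s'}) f
        (fun x hx y hy h => hf x hx.1 y hy.1 h)
        fun x hx => ⟨Set.mem_image_of_mem f hx.1, fun e => hx.2 (hinj hx.1 hs' e)⟩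
    · exact (hS.linked a ha b hb).map (T := f '' S \ {s}) f hf
        fun x hx => ⟨Set.mem_image_of_mem f hx, fun e => hs ⟨x, hx, e⟩⟩

end Biconnected

/-! ### Common descendants in galled-trees -/

section Networks

variable {W : Type u} {N : Digraph W}

/-- `h` is a hybrid-vertex and `S` contains both of its parents and `h` itself. -/
def HybridInside (N : Digraph W) (S : Set W) (h : W) : Prop :=
  h ∈ S ∧ IsHybrid N h ∧ ∀ u, N.Adj u h → u ∈ S

/-- The properties of a galled-tree on which the analysis of its clusters rests: every vertex with
two parents is a hybrid-vertex, and no biconnected set contains two hybrid-vertices together with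
all of their parents. -/
structure IsGalled (N : Digraph W) : Prop where
  acyclic : ∀ v, ¬ Relation.TransGen N.Adj v v
  exists_root : ∃ ρ, ∀ v, IsAncestor N ρ v
  hybrid : ∀ p q h, p ≠ q → N.Adj p h → N.Adj q h → IsHybrid N h
  eq_of_hybridInside : ∀ S, IsBiconnectedSet (underlying N) S → ∀ h h',
    HybridInside N S h → HybridInside N S h' → h = h'

theorem wellFounded_transGen [Finite W] (hac : ∀ v, ¬ Relation.TransGen N.Adj v v) :
    WellFounded (Relation.TransGen N.Adj) := by
  have : IsTrans W (Relation.TransGen N.Adj) := ⟨fun _ _ _ => Relation.TransGen.trans⟩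
  have : Std.Irrefl (Relation.TransGen N.Adj) := ⟨hac⟩
  exact Finite.wellFounded_of_trans_of_irrefl _

theorem wellFounded_flip_transGen [Finite W] (hac : ∀ v, ¬ Relation.TransGen N.Adj v v) :
    WellFounded (flip (Relation.TransGen N.Adj)) := by
  have : IsTrans W (flip (Relation.TransGen N.Adj)) :=
    ⟨fun _ _ _ h h' => Relation.TransGen.trans h' h⟩
  have : Std.Irrefl (flip (Relation.TransGen N.Adj)) := ⟨hac⟩
  exact Finite.wellFounded_of_trans_of_irrefl _

theorem IsAncestor.transGen_of_ne {u v : W} (h : IsAncestor N u v) (hne : u ≠ v) :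
    Relation.TransGen N.Adj u v := by
  rcases Relation.reflTransGen_iff_eq_or_transGen.1 h with e | e
  · exact absurd e.symm hne
  · exact e

theorem IsAncestor.exists_parent {u v : W} (h : IsAncestor N u v) (hne : u ≠ v) :
    ∃ p, IsAncestor N u p ∧ N.Adj p v := by
  rcases Relation.ReflTransGen.cases_tail h with e | ⟨p, hp, hpv⟩
  · exact absurd e.symm hne
  · exact ⟨p, hp, hpv⟩

theorem IsAncestor.antisymm (hac : ∀ v, ¬ Relation.TransGen N.Adj v v) {u v : W}
    (h : IsAncestor N u v) (h' : IsAncestor N v u) : u = v := by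
  by_contra hne
  exact hac u ((h.transGen_of_ne hne).trans_left h')

/-- A directed path is a walk in every set that contains all vertices between its ends. -/
theorem IsAncestor.linked (hac : ∀ v, ¬ Relation.TransGen N.Adj v v) {S : Set W} {a b : W}
    (h : IsAncestor N a b) (hS : ∀ w, IsAncestor N a w → IsAncestor N w b → w ∈ S) :
    Linked (underlying N) S a b := by
  induction h with
  | refl => exact .refl
  | @tail c d hc hcd ih =>
    refine (ih fun w h1 h2 => hS w h1 (h2.tail hcd)).tail ⟨?_, hS c hc (.single hcd),
      hS d (hc.tail hcd) .refl⟩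
    rw [underlying, SimpleGraph.fromRel_adj]
    exact ⟨fun e => hac c (by rw [← e] at hcd; exact .single hcd), Or.inl hcd⟩

/-- All vertices on directed paths from `z` to `h`. -/
def between (N : Digraph W) (z h : W) : Set W := {w | IsAncestor N z w ∧ IsAncestor N w h}

/-- If no single inner vertex meets all paths from `z` to `h`, then the vertices on these paths
form a biconnected set. -/
theorem isBiconnectedSet_between (hac : ∀ v, ¬ Relation.TransGen N.Adj v v) {z h : W}
    (hzh : IsAncestor N z h)
    (havoid : ∀ s, s ≠ z → s ≠ h → Linked (underlying N) (between N z h \ {s}) z h) :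
    IsBiconnectedSet (underlying N) (between N z h) := by
  refine ⟨⟨z, .refl, hzh⟩, ?_, fun s => ?_⟩
  · have : ∀ a ∈ between N z h, Linked (underlying N) (between N z h) a h := fun a ha =>
      ha.2.linked hac fun w h1 h2 => ⟨ha.1.trans h1, h2⟩
    exact fun a ha b hb => (this a ha).trans (this b hb).symm
  · have down : ∀ a ∈ between N z h, ¬ IsAncestor N a s →
        Linked (underlying N) (between N z h \ {s}) a h := fun a ha has =>
      ha.2.linked hac fun w h1 h2 => ⟨⟨ha.1.trans h1, h2⟩, fun e => has (e ▸ h1)⟩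
    have up : ∀ a ∈ between N z h, ¬ IsAncestor N s a →
        Linked (underlying N) (between N z h \ {s}) z a := fun a ha has =>
      ha.1.linked hac fun w h1 h2 => ⟨⟨h1, h2.trans ha.2⟩, fun e => has (e ▸ h2)⟩
    by_cases hsz : s = z
    · have : ∀ a ∈ between N z h \ {s}, Linked (underlying N) (between N z h \ {s}) a h :=
        fun a ha => down a ha.1 fun h' => ha.2 (IsAncestor.antisymm hac h' (hsz ▸ ha.1.1))
      exact fun a ha b hb => (this a ha).trans (this b hb).symm
    · have : ∀ a ∈ between N z h \ {s}, Linked (underlying N) (between N z h \ {s}) z a := by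
        intro a ha
        by_cases h1 : IsAncestor N s a
        · have h2 : s ≠ h := fun e => ha.2 (IsAncestor.antisymm hac (e ▸ ha.1.2) h1)
          exact (havoid s hsz h2).trans
            (down a ha.1 fun h' => ha.2 (IsAncestor.antisymm hac h' h1)).symm
        · exact up a ha.1 h1
      exact fun a ha b hb => (this a ha).symm.trans (this b hb)

theorem IsGalled.exists_minimal_ancestor [Finite W] (hN : IsGalled N) (u v : W) :
    ∃ z, IsAncestor N z u ∧ IsAncestor N z v ∧
      ∀ s, IsAncestor N z s → IsAncestor N s u → IsAncestor N s v → s = z := by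
  obtain ⟨ρ, hρ⟩ := hN.exists_root
  obtain ⟨z, ⟨h1, h2⟩, hmin⟩ := (wellFounded_flip_transGen hN.acyclic).has_min
    {w | IsAncestor N w u ∧ IsAncestor N w v} ⟨ρ, hρ u, hρ v⟩
  refine ⟨z, h1, h2, fun s hs hu hv => ?_⟩
  by_contra hne
  exact hmin s ⟨hu, hv⟩ (hs.transGen_of_ne fun e => hne e.symm)

/-- `h` is a topmost common descendant of `u` and `v`, reached from them through two different
parents, where `u` and `v` are incomparable. -/
structure Meets (N : Digraph W) (u v h : W) : Prop where
  not_left : ¬ IsAncestor N u v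
  not_right : ¬ IsAncestor N v u
  exists_parents : ∃ p q, N.Adj p h ∧ N.Adj q h ∧ IsAncestor N u p ∧ ¬ IsAncestor N v p ∧
    IsAncestor N v q ∧ ¬ IsAncestor N u q

theorem Meets.symm {u v h : W} (hm : Meets N u v h) : Meets N v u h := by
  obtain ⟨h1, h2, p, q, hp, hq, h3, h4, h5, h6⟩ := hm
  exact ⟨h2, h1, q, p, hq, hp, h5, h6, h3, h4⟩

theorem Meets.left_anc {u v h : W} (hm : Meets N u v h) : IsAncestor N u h := by
  obtain ⟨h1, h2, p, q, hp, hq, h3, h4, h5, h6⟩ := hm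
  exact h3.tail hp

theorem Meets.right_anc {u v h : W} (hm : Meets N u v h) : IsAncestor N v h := hm.symm.left_anc

/-- A common descendant of incomparable vertices lies below a vertex in which they meet. -/
theorem exists_meets [Finite W] (hac : ∀ v, ¬ Relation.TransGen N.Adj v v) {u v x : W}
    (huv : ¬ IsAncestor N u v) (hvu : ¬ IsAncestor N v u) (hux : IsAncestor N u x)
    (hvx : IsAncestor N v x) : ∃ h, Meets N u v h ∧ IsAncestor N h x := by
  obtain ⟨h, ⟨h1, h2, h3⟩, hmin⟩ := (wellFounded_transGen hac).has_min
    {w | IsAncestor N u w ∧ IsAncestor N v w ∧ IsAncestor N w x} ⟨x, hux, hvx, .refl⟩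
  have aux : ∀ p, N.Adj p h → IsAncestor N u p → IsAncestor N v p → False := fun p hp hu hv =>
    hmin p ⟨hu, hv, Relation.ReflTransGen.trans (.single hp) h3⟩ (.single hp)
  obtain ⟨p, hp, hph⟩ := h1.exists_parent (fun e => hvu (e ▸ h2))
  obtain ⟨q, hq, hqh⟩ := h2.exists_parent (fun e => huv (e ▸ h1))
  exact ⟨h, ⟨huv, hvu, p, q, hph, hqh, hp, fun h' => aux p hph hp h', hq,
    fun h' => aux q hqh h' hq⟩, h3⟩

/-- A vertex with two parents has no further parents. -/
theorem IsGalled.parent_eq [Finite W] (hN : IsGalled N) {p q h r : W} (hpq : p ≠ q)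
    (hp : N.Adj p h) (hq : N.Adj q h) (hr : N.Adj r h) : r = p ∨ r = q := by
  have h2 : ({u | N.Adj u h} : Set W).ncard = 2 := (hN.hybrid p q h hpq hp hq).1
  have hsub : ({p, q} : Set W) ⊆ {u | N.Adj u h} := by
    rintro x (rfl | rfl)
    · exact hp
    · exact hq
  have := Set.eq_of_subset_of_ncard_le hsub (by rw [h2, Set.ncard_pair hpq])
  exact this.symm.subset hr

/-- If `u` and `v` meet in `h`, the paths from a minimal common ancestor of `u` and `v` to `h` form
a biconnected set that contains `h` and its parents. -/
theorem IsGalled.exists_between_of_meets [Finite W] (hN : IsGalled N) {u v h : W}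
    (hm : Meets N u v h) : ∃ z, IsAncestor N z u ∧ z ≠ u ∧
      IsBiconnectedSet (underlying N) (between N z h) ∧ HybridInside N (between N z h) h := by
  have hac := hN.acyclic
  obtain ⟨z, hzu, hzv, hz⟩ := hN.exists_minimal_ancestor u v
  have huh := hm.left_anc
  have hvh := hm.right_anc
  obtain ⟨huv, hvu, p, q, hp, hq, hup, hvp, hvq, huq⟩ := hm
  have hpq : p ≠ q := fun e => hvp (e ▸ hvq)
  have hzh : IsAncestor N z h := hzu.trans huh
  refine ⟨z, hzu, fun e => huv (e ▸ hzv), isBiconnectedSet_between hac hzh ?_,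
    ⟨hzh, .refl⟩, hN.hybrid p q h hpq hp hq, fun r hr => ?_⟩
  · intro s hsz hsh
    -- the path via `w` and its descendant `r` avoids `s` unless `s` lies on it
    have path : ∀ w r, IsAncestor N z w → IsAncestor N w r → N.Adj r h →
        ¬ (IsAncestor N z s ∧ IsAncestor N s w) → ¬ (IsAncestor N w s ∧ IsAncestor N s r) →
        Linked (underlying N) (between N z h \ {s}) z h := by
      intro w r hzw hwr hr h1 h2
      have hrh : IsAncestor N r h := .single hr
      have l1 : Linked (underlying N) (between N z h \ {s}) z w := hzw.linked hac
        fun a ha hb => ⟨⟨ha, hb.trans (hwr.trans hrh)⟩, fun e => h1 (e ▸ ⟨ha, hb⟩)⟩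
      have l2 : Linked (underlying N) (between N z h \ {s}) w r := hwr.linked hac
        fun a ha hb => ⟨⟨hzw.trans ha, hb.trans hrh⟩, fun e => h2 (e ▸ ⟨ha, hb⟩)⟩
      have hrs : r ≠ s := fun e => h2 ⟨e ▸ hwr, e ▸ .refl⟩
      refine (l1.trans l2).tail ⟨?_, ⟨⟨hzw.trans hwr, hrh⟩, hrs⟩, ⟨hzh, .refl⟩, hsh.symm⟩
      rw [underlying, SimpleGraph.fromRel_adj]
      exact ⟨fun e => hac r (by rw [← e] at hr; exact .single hr), Or.inl hr⟩
    by_cases h1 : (IsAncestor N z s ∧ IsAncestor N s u) ∨ (IsAncestor N u s ∧ IsAncestor N s p)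
    · refine path v q hzv hvq hq ?_ ?_
      · rintro ⟨h2, h3⟩
        rcases h1 with h1 | h1
        · exact hsz (hz s h2 h1.2 h3)
        · exact huv (h1.1.trans h3)
      · rintro ⟨h2, h3⟩
        rcases h1 with h1 | h1
        · exact hvu (h2.trans h1.2)
        · exact hvp (h2.trans h1.2)
    · exact path u p hzu hup hp (fun h => h1 (Or.inl h)) (fun h => h1 (Or.inr h))
  · refine ⟨?_, .single hr⟩
    rcases hN.parent_eq hpq hp hq hr with rfl | rfl
    · exact hzu.trans hup
    · exact hzv.trans hvq

/-- The paths from a minimal common ancestor of the two parents of `h` to `h` form a biconnected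
set. -/
theorem IsGalled.exists_between_of_parents [Finite W] (hN : IsGalled N) {p q h : W} (hpq : p ≠ q)
    (hp : N.Adj p h) (hq : N.Adj q h) :
    ∃ z, IsBiconnectedSet (underlying N) (between N z h) ∧ HybridInside N (between N z h) h := by
  have hac := hN.acyclic
  obtain ⟨z, hzp, hzq, hz⟩ := hN.exists_minimal_ancestor p q
  have hzh : IsAncestor N z h := hzp.tail hp
  refine ⟨z, isBiconnectedSet_between hac hzh ?_, ⟨hzh, .refl⟩,
    hN.hybrid p q h hpq hp hq, fun r hr => ?_⟩
  · intro s hsz hsh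
    have path : ∀ r, IsAncestor N z r → N.Adj r h → ¬ (IsAncestor N z s ∧ IsAncestor N s r) →
        Linked (underlying N) (between N z h \ {s}) z h := by
      intro r hzr hr h1
      have hrh : IsAncestor N r h := .single hr
      have l1 : Linked (underlying N) (between N z h \ {s}) z r := hzr.linked hac
        fun a ha hb => ⟨⟨ha, hb.trans hrh⟩, fun e => h1 (e ▸ ⟨ha, hb⟩)⟩
      have hrs : r ≠ s := fun e => h1 ⟨e ▸ hzr, e ▸ .refl⟩
      refine l1.tail ⟨?_, ⟨⟨hzr, hrh⟩, hrs⟩, ⟨hzh, .refl⟩, hsh.symm⟩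
      rw [underlying, SimpleGraph.fromRel_adj]
      exact ⟨fun e => hac r (by rw [← e] at hr; exact .single hr), Or.inl hr⟩
    by_cases h1 : IsAncestor N z s ∧ IsAncestor N s p
    · exact path q hzq hq fun h2 => hsz (hz s h1.1 h1.2 h2.2)
    · exact path p hzp hp h1
  · refine ⟨?_, .single hr⟩
    rcases hN.parent_eq hpq hp hq hr with rfl | rfl
    · exact hzp
    · exact hzq

theorem HybridInside.mono {S T : Set W} {h : W} (hS : HybridInside N S h) (hST : S ⊆ T) :
    HybridInside N T h := ⟨hST hS.1, hS.2.1, fun u hu => hST (hS.2.2 u hu)⟩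

theorem IsGalled.adj_ne (hN : IsGalled N) {a b : W} (h : N.Adj a b) : a ≠ b := by
  rintro rfl
  exact hN.acyclic a (.single h)

/-- A vertex that meets another one is not a hybrid-vertex: the two cycles would share an edge. -/
theorem Meets.parent_unique [Finite W] (hN : IsGalled N) {u v h q q' : W} (hm : Meets N u v h)
    (hq : N.Adj q u) (hq' : N.Adj q' u) : q = q' := by
  by_contra hne
  obtain ⟨z, hzu, hzne, hB, hh⟩ := hN.exists_between_of_meets hm
  obtain ⟨z', hB', hh'⟩ := hN.exists_between_of_parents hne hq hq'
  obtain ⟨r, hzr, hru⟩ := hzu.exists_parent hzne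
  have huh := hm.left_anc
  have hun := hB.union hB' (hN.adj_ne hru)
    ⟨⟨hzr, Relation.ReflTransGen.trans (.single hru) huh⟩, hh'.2.2 r hru⟩ ⟨⟨hzu, huh⟩, hh'.1⟩
  have : h = u := hN.eq_of_hybridInside _ hun h u (hh.mono Set.subset_union_left)
    (hh'.mono Set.subset_union_right)
  exact hm.not_right (this ▸ hm.right_anc)

/-- All vertices that meet `u` meet it in the same hybrid-vertex. -/
theorem Meets.eq [Finite W] (hN : IsGalled N) {u v w h k : W} (hm : Meets N u v h)
    (hm' : Meets N u w k) : h = k := by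
  obtain ⟨z, hzu, hzne, hB, hh⟩ := hN.exists_between_of_meets hm
  obtain ⟨z', hzu', hzne', hB', hh'⟩ := hN.exists_between_of_meets hm'
  obtain ⟨r, hzr, hru⟩ := hzu.exists_parent hzne
  obtain ⟨r', hzr', hru'⟩ := hzu'.exists_parent hzne'
  obtain rfl := hm.parent_unique hN hru hru'
  have hun := hB.union hB' (hN.adj_ne hru)
    ⟨⟨hzr, Relation.ReflTransGen.trans (.single hru) hm.left_anc⟩,
      ⟨hzr', Relation.ReflTransGen.trans (.single hru) hm'.left_anc⟩⟩
    ⟨⟨hzu, hm.left_anc⟩, ⟨hzu', hm'.left_anc⟩⟩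
  exact hN.eq_of_hybridInside _ hun h k (hh.mono Set.subset_union_left)
    (hh'.mono Set.subset_union_right)

/-- If `u` and `v` meet in `h`, their common descendants are the descendants of `h`. -/
theorem Meets.anc_iff [Finite W] (hN : IsGalled N) {u v h : W} (hm : Meets N u v h) (x : W) :
    IsAncestor N u x ∧ IsAncestor N v x ↔ IsAncestor N h x := by
  constructor
  · rintro ⟨h1, h2⟩
    obtain ⟨k, hk, hkx⟩ := exists_meets hN.acyclic hm.not_left hm.not_right h1 h2
    rwa [hm.eq hN hk]
  · exact fun h => ⟨hm.left_anc.trans h, hm.right_anc.trans h⟩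

/-- No three vertices meet pairwise, since a hybrid-vertex has only two parents. -/
theorem Meets.not_three [Finite W] (hN : IsGalled N) {a b c h₁ h₂ h₃ : W} (hab : Meets N a b h₁)
    (hac : Meets N a c h₂) : ¬ Meets N b c h₃ := by
  intro hbc
  obtain rfl := hab.eq hN hac
  obtain rfl := hab.symm.eq hN hbc
  obtain ⟨-, -, p, q, hp, hq, h1, h2, h3, h4⟩ := hab
  obtain ⟨-, -, p', q', hp', hq', h1', h2', h3', h4'⟩ := hac
  obtain ⟨-, -, p'', q'', hp'', hq'', h1'', h2'', h3'', h4''⟩ := hbc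
  have hpq : p ≠ q := fun e => h2 (e ▸ h3)
  have e1 : p' = p := (hN.parent_eq hpq hp hq hp').resolve_right fun e => h4 (e ▸ h1')
  have e2 : p'' = q := (hN.parent_eq hpq hp hq hp'').resolve_left fun e => h2 (e ▸ h1'')
  rcases hN.parent_eq hpq hp hq hq' with e | e
  · exact h4' (e ▸ h1)
  · exact h2'' (by rw [e2, ← e]; exact h3')

/-- Any two vertices have a least common ancestor. -/
theorem IsGalled.exists_lca [Finite W] (hN : IsGalled N) (x y : W) :
    ∃ l, IsAncestor N l x ∧ IsAncestor N l y ∧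
      ∀ w, IsAncestor N w x → IsAncestor N w y → IsAncestor N w l := by
  obtain ⟨l, hx, hy, hl⟩ := hN.exists_minimal_ancestor x y
  refine ⟨l, hx, hy, fun w hwx hwy => ?_⟩
  by_contra hwl
  by_cases hlw : IsAncestor N l w
  · exact hwl (by rw [hl w hlw hwx hwy]; exact .refl)
  · obtain ⟨h, hm, -⟩ := exists_meets hN.acyclic hlw hwl hx hwx
    have := hl h hm.left_anc ((hm.anc_iff hN x).1 ⟨hx, hwx⟩) ((hm.anc_iff hN y).1 ⟨hy, hwy⟩)
    exact hwl (this ▸ hm.right_anc)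

theorem isLCA_pair_iff (hac : ∀ v, ¬ Relation.TransGen N.Adj v v) {x y l : W}
    (hx : IsAncestor N l x) (hy : IsAncestor N l y)
    (hl : ∀ w, IsAncestor N w x → IsAncestor N w y → IsAncestor N w l) (u : W) :
    IsLCA N {x, y} u ↔ u = l := by
  constructor
  · rintro ⟨h1, h2⟩
    refine (h2 l ?_ (hl u (h1 x (by simp)) (h1 y (by simp)))).symm
    rintro a (rfl | rfl) <;> assumption
  · rintro rfl
    refine ⟨by rintro a (rfl | rfl) <;> assumption, fun w hw huw => ?_⟩
    exact IsAncestor.antisymm hac (hl w (hw x (by simp)) (hw y (by simp))) huw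

/-- The clusters of a galled-tree explain the graph on any family of its leaves. -/
theorem IsGalled.exists_isClusterSystem [Finite W] (hN : IsGalled N) {V : Type*}
    (G : SimpleGraph V) (φ : V → W) (t : W → Label)
    (hG : ∀ x y, x ≠ y → (G.Adj x y ↔ ∃ u, IsLCA N {φ x, φ y} u ∧ t u = Label.one)) :
    ∃ 𝓒 c, IsClusterSystem G 𝓒 c := by
  choose l hlx hly hl using hN.exists_lca
  let cl : W → Set V := fun u => {x | IsAncestor N u (φ x)}
  have hov : ∀ u v, Overlap (cl u) (cl v) → ∃ h, Meets N u v h := by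
    rintro u v ⟨⟨x, hxu, hxv⟩, h1, h2⟩
    obtain ⟨h, hm, -⟩ := exists_meets hN.acyclic
      (fun h : IsAncestor N u v => h2 fun a (ha : IsAncestor N v (φ a)) => h.trans ha)
      (fun h : IsAncestor N v u => h1 fun a (ha : IsAncestor N u (φ a)) => h.trans ha) hxu hxv
    exact ⟨h, hm⟩
  refine ⟨Set.range cl, fun x y => cl (l (φ x) (φ y)), ⟨fun x y => ⟨_, rfl⟩,
    fun x y => hlx _ _, fun x y => hly _ _, ?_, ?_, ?_, ?_⟩⟩
  · rintro _ ⟨u, rfl⟩ x hx y hy a ha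
    exact (hl (φ x) (φ y) u hx hy).trans ha
  · intro x y x' y' hxy hxy' he
    have h1 : IsAncestor N (l (φ x') (φ y')) (l (φ x) (φ y)) :=
      hl _ _ _ (he.subset (hlx (φ x) (φ y))) (he.subset (hly (φ x) (φ y)))
    have h2 : IsAncestor N (l (φ x) (φ y)) (l (φ x') (φ y')) :=
      hl _ _ _ (he.symm.subset (hlx (φ x') (φ y'))) (he.symm.subset (hly (φ x') (φ y')))
    have h3 := IsAncestor.antisymm hN.acyclic h1 h2
    rw [hG x y hxy, hG x' y' hxy']
    simp only [isLCA_pair_iff hN.acyclic (hlx _ _) (hly _ _) (hl _ _), exists_eq_left, h3]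
  · rintro _ ⟨u, rfl⟩ _ ⟨v, rfl⟩ _ ⟨w, rfl⟩ h1 h2
    obtain ⟨h, hm⟩ := hov u v h1
    obtain ⟨k, hm'⟩ := hov u w h2
    obtain rfl := hm.eq hN hm'
    ext a
    exact (hm.anc_iff hN (φ a)).trans (hm'.anc_iff hN (φ a)).symm
  · rintro _ ⟨u, rfl⟩ _ ⟨v, rfl⟩ _ ⟨w, rfl⟩ h1 h2 h3
    obtain ⟨h, hm⟩ := hov u v h1
    obtain ⟨k, hm'⟩ := hov u w h2
    obtain ⟨j, hm''⟩ := hov v w h3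
    exact hm.not_three hN hm' hm''

/-- A nontrivial network reaches every vertex from its root. -/
theorem isAncestor_of_root [Finite W] (hac : ∀ v, ¬ Relation.TransGen N.Adj v v) {ρ : W}
    (hρ : ∀ v, indeg N v = 0 → v = ρ) (v : W) : IsAncestor N ρ v := by
  induction v using (wellFounded_transGen hac).induction with
  | _ v ih =>
  by_cases hv : v = ρ
  · subst hv; exact .refl
  · have : ({u | N.Adj u v} : Set W).Nonempty := by
      by_contra hne
      exact hv (hρ v (by rw [indeg, Set.not_nonempty_iff_eq_empty.1 hne, Set.ncard_empty]))
    obtain ⟨u, hu⟩ := this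
    exact (ih u (.single hu)).tail hu

theorem two_le_indeg [Finite W] {p q h : W} (hpq : p ≠ q) (hp : N.Adj p h) (hq : N.Adj q h) :
    2 ≤ indeg N h := by
  rw [indeg, ← Set.ncard_pair hpq]
  refine Set.ncard_le_ncard ?_
  rintro x (rfl | rfl)
  · exact hp
  · exact hq

/-- In the condition on biconnected components, maximality is irrelevant, as every biconnected set
extends to a biconnected component. -/
theorem hybridInside_unique_iff [Finite W] :
    (∀ C, IsBiconnectedComponent (underlying N) C →
      {h | h ∈ C ∧ IsHybrid N h ∧ ∀ u, N.Adj u h → u ∈ C}.Subsingleton) ↔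
    ∀ S, IsBiconnectedSet (underlying N) S → ∀ h h',
      HybridInside N S h → HybridInside N S h' → h = h' := by
  constructor
  · intro H S hS h h' hh hh'
    obtain ⟨C, hSC, hC⟩ := Set.Finite.exists_le_maximal
      (Set.toFinite {B : Set W | IsBiconnected ((underlying N).induce B)})
      (show S ∈ _ from isBiconnected_induce_iff.2 hS)
    exact H C hC (hh.mono hSC) (hh'.mono hSC)
  · intro H C hC h hh h' hh'
    exact H C (isBiconnected_induce_iff.1 hC.prop) h h' hh hh'

theorem IsNontrivialNetwork.isGalled [Finite W] (hac : ∀ v, ¬ Relation.TransGen N.Adj v v)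
    {X : Set W} (hN : IsNontrivialNetwork N X) : IsGalled N := by
  obtain ⟨ρ, ⟨h0, h2, hρ⟩, hX, hV, hC⟩ := hN
  refine ⟨hac, ⟨ρ, isAncestor_of_root hac hρ⟩, fun p q h hpq hp hq => ?_,
    hybridInside_unique_iff.1 hC⟩
  have h2 := two_le_indeg hpq hp hq
  have hhX : h ∉ X := fun hh => by have := ((hX h).1 hh).2; omega
  have hhρ : h ≠ ρ := fun hh => by rw [hh] at h2; omega
  rcases hV h hhX hhρ with h3 | h3
  · have := h3.1; omega
  · exact h3

/-- Primitive induced subgraphs of galled-tree explainable graphs are pseudo-cographs. -/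
theorem IsGaTEx.isPseudoCograph {V : Type*} [Finite V] {G : SimpleGraph V} (hG : IsGaTEx G)
    (S : Set V) (hS : IsPrimitive (G.induce S)) : IsPseudoCograph (G.induce S) := by
  obtain ⟨W, N, X, t, ⟨hfin, hac, hshape⟩, ht, ⟨e⟩⟩ := hG
  rcases hshape with ⟨x, hx, hX⟩ | hnet
  · exfalso
    have hsub : Subsingleton W := ⟨fun a b => by
      have ha : a ∈ ({x} : Set W) := hx ▸ Set.mem_univ a
      have hb : b ∈ ({x} : Set W) := hx ▸ Set.mem_univ b
      exact ha.trans hb.symm⟩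
    have : Subsingleton V := e.toEquiv.subsingleton
    have h1 := Finite.card_le_one_iff_subsingleton.2 (inferInstance : Subsingleton S)
    have h2 := hS.1
    omega
  · obtain ⟨𝓒, c, h⟩ := (hnet.isGalled hac).exists_isClusterSystem (G.induce S)
      (fun x => ((e x : X) : W)) t fun x y hxy => by
        have h1 : (G.induce S).Adj x y ↔ (explainedGraph N X t).Adj (e x) (e y) :=
          (e.map_adj_iff (v := (x : V)) (w := (y : V))).symm
        rw [h1]
        refine and_iff_right fun he => hxy (Subtype.ext (e.injective he))
    exact h.isPseudoCograph hS

end Networks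

/-! ### Substituting a galled-tree for a leaf -/

section Substitution

/-- The labeled network `(N, t)` with leaf set `X` explains `G`, where the vertex `v` of `G`
corresponds to the leaf `φ v`. -/
structure Explains {V W : Type*} (N : Digraph W) (X : Set W) (t : W → Label) (G : SimpleGraph V)
    (φ : V → W) : Prop where
  injective : Function.Injective φ
  range_eq : Set.range φ = X
  adj_iff : ∀ v w, v ≠ w → (G.Adj v w ↔ ∃ u, IsLCA N {φ v, φ w} u ∧ t u = Label.one)

theorem isGaTEx_iff {V : Type*} {G : SimpleGraph V} :
    IsGaTEx G ↔ ∃ (W : Type) (N : Digraph W) (X : Set W) (t : W → Label) (φ : V → W),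
      IsGalledTree N X ∧ IsLabeling X t ∧ Explains N X t G φ := by
  constructor
  · rintro ⟨W, N, X, t, hN, ht, ⟨e⟩⟩
    refine ⟨W, N, X, t, fun v => (e v : X), hN, ht,
      fun v w h => e.injective (Subtype.ext h), ?_, fun v w hvw => ?_⟩
    · ext x
      exact ⟨fun ⟨v, hv⟩ => hv ▸ (e v).2,
        fun hx => ⟨e.symm ⟨x, hx⟩, by simp⟩⟩
    · rw [← e.map_adj_iff]
      exact and_iff_right fun he => hvw (e.injective he)
  · rintro ⟨W, N, X, t, φ, hN, ht, ⟨hinj, rfl, hadj⟩⟩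
    refine ⟨W, N, _, t, hN, ht, ⟨⟨Equiv.ofInjective φ hinj, ?_⟩⟩⟩
    intro v w
    by_cases hvw : v = w
    · subst hvw
      exact ⟨fun h => absurd h (SimpleGraph.irrefl _), fun h => absurd h (SimpleGraph.irrefl _)⟩
    · rw [hadj v w hvw]
      exact and_iff_right fun he => hvw ((Equiv.ofInjective φ hinj).injective he)

theorem isLCA_pair {W : Type*} {N : Digraph W} {p q u : W} :
    IsLCA N {p, q} u ↔ IsAncestor N u p ∧ IsAncestor N u q ∧
      ∀ w, IsAncestor N w p → IsAncestor N w q → IsAncestor N u w → w = u := by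
  simp [IsLCA, and_assoc]

variable {W₁ W₂ : Type*}

/-- The network obtained from `N₁` by replacing the leaf `x` with the root `ρ` of `N₂`. -/
def subst (N₁ : Digraph W₁) (x : W₁) (N₂ : Digraph W₂) (ρ : W₂) : Digraph ({w // w ≠ x} ⊕ W₂) where
  Adj
    | .inl a, .inl b => N₁.Adj a b
    | .inl a, .inr b => N₁.Adj a x ∧ b = ρ
    | .inr a, .inr b => N₂.Adj a b
    | .inr _, .inl _ => False

/-- The projection that contracts the copy of `N₂` to the leaf `x`. -/
def substProj (x : W₁) : {w // w ≠ x} ⊕ W₂ → W₁ := Sum.elim (fun a => a.1) fun _ => x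

@[simp] theorem substProj_inl (x : W₁) (a : {w // w ≠ x}) :
    substProj (W₂ := W₂) x (.inl a) = a := rfl

@[simp] theorem substProj_inr (x : W₁) (b : W₂) : substProj x (.inr b) = x := rfl

variable {N₁ : Digraph W₁} {x : W₁} {N₂ : Digraph W₂} {ρ : W₂}

theorem not_subst_adj_inr_inl {a b} : ¬ (subst N₁ x N₂ ρ).Adj (.inr a) (.inl b) := fun h => h

theorem subst_anc_of_inr {a : W₂} {v} (h : IsAncestor (subst N₁ x N₂ ρ) (.inr a) v) :
    ∃ b, v = .inr b ∧ IsAncestor N₂ a b := by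
  induction h with
  | refl => exact ⟨a, rfl, .refl⟩
  | @tail c d _ h ih =>
    obtain ⟨b, rfl, hb⟩ := ih
    rcases d with d | d
    · exact absurd h not_subst_adj_inr_inl
    · exact ⟨d, rfl, hb.tail h⟩

theorem subst_anc_inr_inr {a b : W₂} :
    IsAncestor (subst N₁ x N₂ ρ) (.inr a) (.inr b) ↔ IsAncestor N₂ a b := by
  constructor
  · intro h
    obtain ⟨b', hb', h⟩ := subst_anc_of_inr h
    rwa [Sum.inr.inj hb']
  · intro h
    induction h with
    | refl => exact .refl
    | tail _ h ih => exact Relation.ReflTransGen.tail ih h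

theorem not_subst_anc_inr_inl {a : W₂} {b} :
    ¬ IsAncestor (subst N₁ x N₂ ρ) (.inr a) (.inl b) := by
  intro h
  obtain ⟨b', hb', -⟩ := subst_anc_of_inr h
  cases hb'

/-- Below a vertex of `N₁`, ancestry is that of `N₁` with `N₂` contracted to `x`. -/
theorem subst_anc_inl (hx : ∀ w, ¬ N₁.Adj x w) (hρ : ∀ v, IsAncestor N₂ ρ v) {a : {w // w ≠ x}}
    {q} : IsAncestor (subst N₁ x N₂ ρ) (.inl a) q ↔ IsAncestor N₁ a (substProj x q) := by
  constructor
  · intro h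
    induction h with
    | refl => exact .refl
    | @tail c d _ h ih =>
      rcases c with c | c <;> rcases d with d | d
      · exact ih.tail h
      · exact ih.tail h.1
      · exact absurd h not_subst_adj_inr_inl
      · exact ih
  · have key : ∀ b, IsAncestor N₁ a b → ∀ hb : b ≠ x,
        IsAncestor (subst N₁ x N₂ ρ) (.inl a) (.inl ⟨b, hb⟩) := by
      intro b h
      induction h with
      | refl => exact fun _ => .refl
      | @tail c d _ h ih =>
        intro hb
        have hc : c ≠ x := fun e => hx d (e ▸ h)
        exact (ih hc).tail h
    intro h
    rcases q with q | q
    · exact key q h q.2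
    · obtain ⟨p, hap, hpx⟩ := h.exists_parent a.2
      have hp : p ≠ x := fun e => hx x (e ▸ hpx)
      have h1 : IsAncestor (subst N₁ x N₂ ρ) (.inl a) (.inr ρ) :=
        (key p hap hp).tail ⟨hpx, rfl⟩
      exact h1.trans (subst_anc_inr_inr.2 (hρ q))

theorem subst_acyclic (hx : ∀ w, ¬ N₁.Adj x w) (hρ : ∀ v, IsAncestor N₂ ρ v)
    (hac₁ : ∀ v, ¬ Relation.TransGen N₁.Adj v v) (hac₂ : ∀ v, ¬ Relation.TransGen N₂.Adj v v) :
    ∀ v, ¬ Relation.TransGen (subst N₁ x N₂ ρ).Adj v v := by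
  intro v hv
  obtain ⟨w, hvw, hwv⟩ := Relation.TransGen.head'_iff.1 hv
  rcases v with v | v <;> rcases w with w | w
  · exact hac₁ v (Relation.TransGen.head' hvw ((subst_anc_inl hx hρ).1 hwv))
  · exact not_subst_anc_inr_inl hwv
  · exact not_subst_adj_inr_inl hvw
  · exact hac₂ v (Relation.TransGen.head' hvw (subst_anc_inr_inr.1 hwv))

theorem substProj_injOn {ρ : W₂} {S : Set ({w // w ≠ x} ⊕ W₂)}
    (hS : ∀ b, Sum.inr b ∈ S → b = ρ) : Set.InjOn (substProj x) S := by
  rintro (a | a) ha (b | b) hb h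
  · exact congrArg Sum.inl (Subtype.ext h)
  · exact absurd h a.2
  · exact absurd h.symm b.2
  · rw [hS a ha, hS b hb]

theorem subst_indeg_inl (hx : ∀ w, ¬ N₁.Adj x w) (b : {w // w ≠ x}) :
    indeg (subst N₁ x N₂ ρ) (.inl b) = indeg N₁ b := by
  have himg : substProj x '' {u | (subst N₁ x N₂ ρ).Adj u (.inl b)} = {u | N₁.Adj u b} := by
    ext u
    constructor
    · rintro ⟨u | u, hu, rfl⟩
      · exact hu
      · exact False.elim hu
    · intro hu
      exact ⟨.inl ⟨u, fun e => hx b (e ▸ hu)⟩, hu, rfl⟩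
  rw [indeg, indeg, ← himg, (substProj_injOn (ρ := ρ) ?_).ncard_image]
  exact fun a ha => False.elim ha

theorem subst_outdeg_inl (a : {w // w ≠ x}) :
    outdeg (subst N₁ x N₂ ρ) (.inl a) = outdeg N₁ a := by
  have himg : substProj x '' {w | (subst N₁ x N₂ ρ).Adj (.inl a) w} = {w | N₁.Adj a w} := by
    ext u
    constructor
    · rintro ⟨u | u, hu, rfl⟩
      · exact hu
      · exact hu.1
    · intro hu
      by_cases h : u = x
      · subst h; exact ⟨.inr ρ, ⟨hu, rfl⟩, rfl⟩
      · exact ⟨.inl ⟨u, h⟩, hu, rfl⟩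
  rw [outdeg, outdeg, ← himg, (substProj_injOn (ρ := ρ) ?_).ncard_image]
  exact fun b hb => hb.2

theorem subst_indeg_root (hx : ∀ w, ¬ N₁.Adj x w) (hρ : ∀ w, ¬ N₂.Adj w ρ) :
    indeg (subst N₁ x N₂ ρ) (.inr ρ) = indeg N₁ x := by
  have himg : substProj x '' {u | (subst N₁ x N₂ ρ).Adj u (.inr ρ)} = {u | N₁.Adj u x} := by
    ext u
    constructor
    · rintro ⟨u | u, hu, rfl⟩
      · exact hu.1
      · exact absurd hu (hρ u)
    · intro hu
      exact ⟨.inl ⟨u, fun e => hx x (e ▸ hu)⟩, ⟨hu, rfl⟩, rfl⟩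
  rw [indeg, indeg, ← himg, (substProj_injOn (ρ := ρ) ?_).ncard_image]
  exact fun a ha => absurd ha (hρ a)

theorem subst_indeg_inr {b : W₂} (hb : b ≠ ρ) :
    indeg (subst N₁ x N₂ ρ) (.inr b) = indeg N₂ b := by
  have himg : {u | (subst N₁ x N₂ ρ).Adj u (.inr b)} = Sum.inr '' {u | N₂.Adj u b} := by
    ext u
    constructor
    · intro hu
      rcases u with u | u
      · exact absurd hu.2 hb
      · exact ⟨u, hu, rfl⟩
    · rintro ⟨u, hu, rfl⟩
      exact hu
  rw [indeg, indeg, himg, Set.ncard_image_of_injective _ Sum.inr_injective]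

theorem subst_outdeg_inr (b : W₂) : outdeg (subst N₁ x N₂ ρ) (.inr b) = outdeg N₂ b := by
  have himg : {u | (subst N₁ x N₂ ρ).Adj (.inr b) u} = Sum.inr '' {u | N₂.Adj b u} := by
    ext u
    constructor
    · intro hu
      rcases u with u | u
      · exact False.elim hu
      · exact ⟨u, hu, rfl⟩
    · rintro ⟨u, hu, rfl⟩
      exact hu
  rw [outdeg, outdeg, himg, Set.ncard_image_of_injective _ Sum.inr_injective]

/-- Lowest common ancestors of a leaf of `N₁` and any other leaf are those in `N₁` after contracting
`N₂` to `x`. -/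
theorem subst_isLCA_inl (hx : ∀ w, ¬ N₁.Adj x w) (hρ : ∀ v, IsAncestor N₂ ρ v)
    (t₁ : W₁ → Label) (t₂ : W₂ → Label) (a : {w // w ≠ x}) (q : {w // w ≠ x} ⊕ W₂) :
    (∃ u, IsLCA (subst N₁ x N₂ ρ) {.inl a, q} u ∧ Sum.elim (fun a => t₁ a.1) t₂ u = Label.one) ↔
      ∃ u, IsLCA N₁ {a.1, substProj x q} u ∧ t₁ u = Label.one := by
  have hne : ∀ w, IsAncestor N₁ w a → w ≠ x := by
    rintro w hw rfl
    rcases Relation.ReflTransGen.cases_head hw with e | ⟨c, hc, -⟩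
    · exact a.2 e.symm
    · exact hx c hc
  have hanc : ∀ {c q}, IsAncestor (subst N₁ x N₂ ρ) (.inl c) q ↔
      IsAncestor N₁ c (substProj x q) := subst_anc_inl hx hρ
  simp only [isLCA_pair]
  constructor
  · rintro ⟨u, ⟨h1, h2, h3⟩, h4⟩
    rcases u with u | u
    · refine ⟨u, ⟨hanc.1 h1, hanc.1 h2, fun w hw hw' huw => ?_⟩, h4⟩
      have := h3 (.inl ⟨w, hne w hw⟩) (hanc.2 hw) (hanc.2 hw') (hanc.2 huw)
      exact congrArg (substProj x) this
    · exact absurd h1 not_subst_anc_inr_inl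
  · rintro ⟨u, ⟨h1, h2, h3⟩, h4⟩
    refine ⟨.inl ⟨u, hne u h1⟩, ⟨hanc.2 h1, hanc.2 h2, fun w hw hw' huw => ?_⟩, h4⟩
    rcases w with w | w
    · exact congrArg Sum.inl (Subtype.ext (h3 w (hanc.1 hw) (hanc.1 hw') (hanc.1 huw)))
    · exact absurd hw not_subst_anc_inr_inl

/-- Lowest common ancestors of two leaves of `N₂` are those in `N₂`, since the root of `N₂` is a
common ancestor below every vertex of `N₁` that is one. -/
theorem subst_isLCA_inr (hx : ∀ w, ¬ N₁.Adj x w) (hρ : ∀ v, IsAncestor N₂ ρ v)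
    (t₁ : W₁ → Label) (t₂ : W₂ → Label) (a b : W₂) :
    (∃ u, IsLCA (subst N₁ x N₂ ρ) {.inr a, .inr b} u ∧
      Sum.elim (fun a => t₁ a.1) t₂ u = Label.one) ↔
      ∃ u, IsLCA N₂ {a, b} u ∧ t₂ u = Label.one := by
  simp only [isLCA_pair]
  constructor
  · rintro ⟨u, ⟨h1, h2, h3⟩, h4⟩
    rcases u with u | u
    · have h5 := h3 (.inr ρ) (subst_anc_inr_inr.2 (hρ a)) (subst_anc_inr_inr.2 (hρ b))
        ((subst_anc_inl hx hρ).2 ((subst_anc_inl (q := .inr a) hx hρ).1 h1))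
      cases h5
    · refine ⟨u, ⟨subst_anc_inr_inr.1 h1, subst_anc_inr_inr.1 h2, fun w hw hw' huw => ?_⟩, h4⟩
      exact Sum.inr.inj (h3 (.inr w) (subst_anc_inr_inr.2 hw) (subst_anc_inr_inr.2 hw')
        (subst_anc_inr_inr.2 huw))
  · rintro ⟨u, ⟨h1, h2, h3⟩, h4⟩
    refine ⟨.inr u, ⟨subst_anc_inr_inr.2 h1, subst_anc_inr_inr.2 h2, fun w hw hw' huw => ?_⟩, h4⟩
    obtain ⟨w, rfl, huw'⟩ := subst_anc_of_inr huw
    rw [h3 w (subst_anc_inr_inr.1 hw) (subst_anc_inr_inr.1 hw') huw']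

/-- The root of `N₂` is a cut vertex, so a biconnected set lies in `N₁` or in `N₂`. -/
theorem subst_biconnectedSet_cases {S : Set ({w // w ≠ x} ⊕ W₂)}
    (hS : IsBiconnectedSet (underlying (subst N₁ x N₂ ρ)) S) :
    (∀ b, Sum.inr b ∈ S → b = ρ) ∨ ∀ a, Sum.inl a ∉ S := by
  by_contra! hcon
  obtain ⟨⟨b, hb, hbρ⟩, a, ha⟩ := hcon
  have hl := hS.linked_diff (.inr ρ) (.inl a) ⟨ha, by simp⟩ (.inr b) ⟨hb, by simpa using hbρ⟩
  have key : ∀ c, Linked (underlying (subst N₁ x N₂ ρ)) (S \ {.inr ρ}) (.inl a) c →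
      ∃ c', c = .inl c' := by
    intro c hc
    induction hc with
    | refl => exact ⟨a, rfl⟩
    | @tail c d _ h ih =>
      obtain ⟨c, rfl⟩ := ih
      rcases d with d | d
      · exact ⟨d, rfl⟩
      · obtain ⟨h1, -, h2⟩ := h
        rw [underlying, SimpleGraph.fromRel_adj] at h1
        rcases h1.2 with h3 | h3
        · exact absurd (congrArg Sum.inr h3.2) h2.2
        · exact absurd h3 not_subst_adj_inr_inl
  obtain ⟨c', hc'⟩ := key _ hl
  cases hc'

/-- No hybrid-vertices are created: the root of `N₂` is a tree-vertex of the composed network, and a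
biconnected set is mapped injectively to `N₁` or to `N₂`. -/
theorem subst_hybridInside_unique (hx : ∀ w, ¬ N₁.Adj x w) (hx1 : indeg N₁ x = 1)
    (hρ : ∀ w, ¬ N₂.Adj w ρ)
    (h₁ : ∀ S, IsBiconnectedSet (underlying N₁) S → ∀ h h',
      HybridInside N₁ S h → HybridInside N₁ S h' → h = h')
    (h₂ : ∀ S, IsBiconnectedSet (underlying N₂) S → ∀ h h',
      HybridInside N₂ S h → HybridInside N₂ S h' → h = h') :
    ∀ S, IsBiconnectedSet (underlying (subst N₁ x N₂ ρ)) S → ∀ h h',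
      HybridInside (subst N₁ x N₂ ρ) S h → HybridInside (subst N₁ x N₂ ρ) S h' → h = h' := by
  intro S hS h h' hh hh'
  have hroot : ∀ h, HybridInside (subst N₁ x N₂ ρ) S h → h ≠ .inr ρ := by
    rintro _ hh rfl
    have h1 := hh.2.1.1
    rw [subst_indeg_root hx hρ, hx1] at h1
    omega
  rcases subst_biconnectedSet_cases hS with hc | hc
  · have hinj := substProj_injOn hc
    have hB : IsBiconnectedSet (underlying N₁) (substProj x '' S) := by
      refine hS.image _ hinj fun a ha b hb hab => ?_
      rw [underlying, SimpleGraph.fromRel_adj] at hab ⊢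
      refine ⟨fun e => hab.1 (hinj ha hb e), ?_⟩
      have arc : ∀ a ∈ S, ∀ b ∈ S, (subst N₁ x N₂ ρ).Adj a b →
          N₁.Adj (substProj x a) (substProj x b) := by
        rintro (a | a) ha (b | b) hb h
        · exact h
        · exact h.1
        · exact absurd h not_subst_adj_inr_inl
        · rw [hc b hb] at h
          exact absurd h (hρ a)
      exact hab.2.imp (arc a ha b hb) (arc b hb a ha)
    have hI : ∀ h, HybridInside (subst N₁ x N₂ ρ) S h →
        HybridInside N₁ (substProj x '' S) (substProj x h) := by
      rintro (h | h) hh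
      · obtain ⟨h1, ⟨h2, h3⟩, h4⟩ := hh
        rw [subst_indeg_inl hx] at h2
        rw [subst_outdeg_inl] at h3
        exact ⟨Set.mem_image_of_mem _ h1, ⟨h2, h3⟩, fun u hu =>
          ⟨.inl ⟨u, fun e => hx h (e ▸ hu)⟩, h4 _ hu, rfl⟩⟩
      · exact absurd (congrArg Sum.inr (hc h hh.1)) (hroot _ hh)
    exact hinj hh.1 hh'.1 (h₁ _ hB _ _ (hI h hh) (hI h' hh'))
  · have hinj : Set.InjOn (Sum.elim (fun _ => ρ) id : {w // w ≠ x} ⊕ W₂ → W₂) S := by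
      rintro (a | a) ha (b | b) hb h
      · exact absurd ha (hc a)
      · exact absurd ha (hc a)
      · exact absurd hb (hc b)
      · exact congrArg Sum.inr h
    have hB := hS.image (G' := underlying N₂) _ hinj fun a ha b hb hab => by
      rcases a with a | a
      · exact absurd ha (hc a)
      rcases b with b | b
      · exact absurd hb (hc b)
      rw [underlying, SimpleGraph.fromRel_adj] at hab ⊢
      exact ⟨fun e => hab.1 (congrArg Sum.inr e), hab.2⟩
    have hI : ∀ h, HybridInside (subst N₁ x N₂ ρ) S h →
        HybridInside N₂ ((Sum.elim (fun _ => ρ) id : {w // w ≠ x} ⊕ W₂ → W₂) '' S)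
          ((Sum.elim (fun _ => ρ) id : {w // w ≠ x} ⊕ W₂ → W₂) h) := by
      rintro (h | h) hh
      · exact absurd hh.1 (hc h)
      · have hne : h ≠ ρ := fun e => hroot _ hh (congrArg Sum.inr e)
        obtain ⟨h1, ⟨h2, h3⟩, h4⟩ := hh
        rw [subst_indeg_inr hne] at h2
        rw [subst_outdeg_inr] at h3
        exact ⟨Set.mem_image_of_mem _ h1, ⟨h2, h3⟩, fun u hu => ⟨.inr u, h4 (.inr u) hu, rfl⟩⟩
    exact hinj hh.1 hh'.1 (h₂ _ hB _ _ (hI h hh) (hI h' hh'))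

theorem not_adj_of_indeg_eq_zero {W : Type*} [Finite W] {N : Digraph W} {v : W}
    (h : indeg N v = 0) (u : W) : ¬ N.Adj u v := fun huv => by
  have := (Set.ncard_eq_zero (Set.toFinite _)).1 h
  exact this.subset huv

theorem not_adj_of_outdeg_eq_zero {W : Type*} [Finite W] {N : Digraph W} {v : W}
    (h : outdeg N v = 0) (u : W) : ¬ N.Adj v u := fun huv => by
  have := (Set.ncard_eq_zero (Set.toFinite _)).1 h
  exact this.subset huv

/-- Replacing a leaf of a nontrivial galled-tree by a nontrivial galled-tree gives a
galled-tree. -/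
theorem isNontrivialNetwork_subst [Finite W₁] [Finite W₂] {X₁ : Set W₁} {X₂ : Set W₂}
    (hN₁ : IsNontrivialNetwork N₁ X₁) (hN₂ : IsNontrivialNetwork N₂ X₂) (hxX : x ∈ X₁)
    (hρ0 : indeg N₂ ρ = 0) :
    IsNontrivialNetwork (subst N₁ x N₂ ρ) {w | Sum.elim (fun a => a.1 ∈ X₁) (· ∈ X₂) w} := by
  obtain ⟨ρ₁, ⟨h10, h12, h1ρ⟩, h1X, h1V, h1C⟩ := hN₁
  obtain ⟨ρ₂, ⟨h20, h22, h2ρ⟩, h2X, h2V, h2C⟩ := hN₂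
  obtain rfl := h2ρ ρ hρ0
  obtain ⟨hx0, hx1⟩ := (h1X x).1 hxX
  have hx := not_adj_of_outdeg_eq_zero hx0
  have hr := not_adj_of_indeg_eq_zero h20
  have hρx : ρ₁ ≠ x := fun e => by rw [e, hx1] at h10; omega
  have hroot : indeg (subst N₁ x N₂ ρ) (.inr ρ) = 1 := (subst_indeg_root hx hr).trans hx1
  refine ⟨.inl ⟨ρ₁, hρx⟩, ⟨?_, ?_, ?_⟩, ?_, ?_, hybridInside_unique_iff.2 ?_⟩
  · rw [subst_indeg_inl hx]; exact h10
  · rw [subst_outdeg_inl]; exact h12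
  · rintro (v | v) hv
    · rw [subst_indeg_inl hx] at hv
      exact congrArg Sum.inl (Subtype.ext (h1ρ v hv))
    · by_cases hvρ : v = ρ
      · rw [hvρ, hroot] at hv; omega
      · rw [subst_indeg_inr hvρ] at hv
        exact absurd (h2ρ v hv) hvρ
  · rintro (v | v)
    · rw [subst_indeg_inl hx, subst_outdeg_inl]
      exact h1X v
    · by_cases hvρ : v = ρ
      · subst hvρ
        rw [hroot, subst_outdeg_inr]
        have : v ∉ X₂ := fun h => by have := ((h2X v).1 h).2; omega
        exact ⟨fun h => absurd h this, fun h => by omega⟩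
      · rw [subst_indeg_inr hvρ, subst_outdeg_inr]
        exact h2X v
  · rintro (v | v) hvX hvρ
    · simp only [IsTreeVertex, IsHybrid, subst_indeg_inl hx, subst_outdeg_inl]
      exact h1V v hvX fun e => hvρ (congrArg Sum.inl (Subtype.ext e))
    · by_cases hv : v = ρ
      · subst hv
        exact Or.inl ⟨hroot, by rw [subst_outdeg_inr]; exact h22⟩
      · simp only [IsTreeVertex, IsHybrid, subst_indeg_inr hv, subst_outdeg_inr]
        exact h2V v hvX hv
  · exact subst_hybridInside_unique hx hx1 hr (hybridInside_unique_iff.1 h1C)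
      (hybridInside_unique_iff.1 h2C)

theorem IsGalledTree.isNontrivialNetwork {V W : Type*} {N : Digraph W} {X : Set W}
    {t : W → Label} {G : SimpleGraph V} {φ : V → W} (hN : IsGalledTree N X)
    (h : Explains N X t G φ) {v w : V} (hvw : v ≠ w) : IsNontrivialNetwork N X := by
  refine hN.shape.resolve_left ?_
  rintro ⟨x, hx, -⟩
  refine hvw (h.injective ?_)
  have h1 : φ v ∈ ({x} : Set W) := hx ▸ Set.mem_univ _
  have h2 : φ w ∈ ({x} : Set W) := hx ▸ Set.mem_univ _
  exact h1.trans h2.symm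

/-- If a module `M` and the graph in which `M` is shrunk to one of its vertices are galled-tree
explainable, then so is the whole graph. -/
theorem isGaTEx_of_isModule {V : Type*} {G : SimpleGraph V} {M : Set V} (hM : IsModule G M)
    {m m' v₀ : V} (hm : m ∈ M) (hm' : m' ∈ M) (hmm : m ≠ m') (hv₀ : v₀ ∉ M)
    (h₁ : IsGaTEx (G.induce (Mᶜ ∪ {m}))) (h₂ : IsGaTEx (G.induce M)) : IsGaTEx G := by
  classical
  obtain ⟨W₁, N₁, X₁, t₁, φ₁, hN₁, ht₁, hE₁⟩ := isGaTEx_iff.1 h₁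
  obtain ⟨W₂, N₂, X₂, t₂, φ₂, hN₂, ht₂, hE₂⟩ := isGaTEx_iff.1 h₂
  have := hN₁.finite
  have := hN₂.finite
  have hn₁ := hN₁.isNontrivialNetwork hE₁ (v := ⟨m, Or.inr rfl⟩) (w := ⟨v₀, Or.inl hv₀⟩)
    (fun e => hv₀ (Subtype.mk.inj e ▸ hm))
  have hn₂ := hN₂.isNontrivialNetwork hE₂ (v := ⟨m, hm⟩) (w := ⟨m', hm'⟩)
    (fun e => hmm (congrArg Subtype.val e))
  have hn₂' := hn₂
  obtain ⟨ρ, ⟨hρ0, -, hρu⟩, -⟩ := hn₂'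
  have hρ := isAncestor_of_root hN₂.acyclic hρu
  have hxX : φ₁ ⟨m, Or.inr rfl⟩ ∈ X₁ := hE₁.range_eq ▸ ⟨_, rfl⟩
  have hn₁' := hn₁
  obtain ⟨-, -, hX₁, -⟩ := hn₁'
  have hx := not_adj_of_outdeg_eq_zero ((hX₁ _).1 hxX).1
  have hne : ∀ v (hv : v ∉ M), φ₁ ⟨v, Or.inl hv⟩ ≠ φ₁ ⟨m, Or.inr rfl⟩ := fun v hv e =>
    hv (by rw [show v = m from congrArg Subtype.val (hE₁.injective e)]; exact hm)
  let φ : V → {w // w ≠ φ₁ ⟨m, Or.inr rfl⟩} ⊕ W₂ := fun v =>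
    if hv : v ∈ M then .inr (φ₂ ⟨v, hv⟩) else .inl ⟨φ₁ ⟨v, Or.inl hv⟩, hne v hv⟩
  have hφ1 : ∀ v (hv : v ∈ M), φ v = .inr (φ₂ ⟨v, hv⟩) := fun v hv => dif_pos hv
  have hφ2 : ∀ v (hv : v ∉ M), φ v = .inl ⟨φ₁ ⟨v, Or.inl hv⟩, hne v hv⟩ := fun v hv => dif_neg hv
  have hadj : ∀ v w, v ≠ w → v ∉ M → (G.Adj v w ↔ ∃ u, IsLCA (subst N₁ _ N₂ ρ) {φ v, φ w} u ∧
      Sum.elim (fun a => t₁ a.1) t₂ u = Label.one) := by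
    intro v w hvw hv
    rw [hφ2 v hv, subst_isLCA_inl hx hρ]
    by_cases hw : w ∈ M
    · rw [hφ1 w hw, substProj_inr, G.adj_comm, hM.adj_iff hw hm hv, G.adj_comm]
      exact hE₁.adj_iff ⟨v, Or.inl hv⟩ ⟨m, Or.inr rfl⟩
        (fun e => hv ((Subtype.mk.inj e).symm ▸ hm))
    · rw [hφ2 w hw, substProj_inl]
      exact hE₁.adj_iff ⟨v, Or.inl hv⟩ ⟨w, Or.inl hw⟩ (fun e => hvw (congrArg Subtype.val e))
  refine isGaTEx_iff.2 ⟨_, subst N₁ (φ₁ ⟨m, Or.inr rfl⟩) N₂ ρ, _,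
    Sum.elim (fun a => t₁ a.1) t₂, φ, ⟨inferInstance, subst_acyclic hx hρ hN₁.acyclic hN₂.acyclic,
      Or.inr (isNontrivialNetwork_subst hn₁ hn₂ hxX hρ0)⟩, ?_, ?_, ?_, ?_⟩
  · rintro (v | v)
    · exact ht₁ v
    · exact ht₂ v
  · intro v w he
    by_cases hv : v ∈ M <;> by_cases hw : w ∈ M
    · rw [hφ1 v hv, hφ1 w hw] at he
      exact congrArg Subtype.val (hE₂.injective (Sum.inr.inj he))
    · rw [hφ1 v hv, hφ2 w hw] at he; cases he
    · rw [hφ2 v hv, hφ1 w hw] at he; cases he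
    · rw [hφ2 v hv, hφ2 w hw] at he
      exact congrArg Subtype.val (hE₁.injective (congrArg Subtype.val (Sum.inl.inj he)))
  · ext w
    constructor
    · rintro ⟨v, rfl⟩
      by_cases hv : v ∈ M
      · rw [hφ1 v hv]
        exact hE₂.range_eq.subset ⟨_, rfl⟩
      · rw [hφ2 v hv]
        exact hE₁.range_eq.subset ⟨_, rfl⟩
    · intro hw
      rcases w with w | w
      · obtain ⟨⟨v, hv⟩, hvw⟩ := hE₁.range_eq.symm.subset hw
        have hvm : v ≠ m := by
          rintro rfl
          exact w.2 hvw.symm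
        have hvM : v ∉ M := hv.resolve_right hvm
        exact ⟨v, by rw [hφ2 v hvM]; exact congrArg Sum.inl (Subtype.ext hvw)⟩
      · obtain ⟨⟨v, hv⟩, hvw⟩ := hE₂.range_eq.symm.subset hw
        exact ⟨v, by rw [hφ1 v hv, hvw]⟩
  · intro v w hvw
    by_cases hv : v ∈ M
    · by_cases hw : w ∈ M
      · rw [hφ1 v hv, hφ1 w hw, subst_isLCA_inr hx hρ]
        exact hE₂.adj_iff ⟨v, hv⟩ ⟨w, hw⟩ (fun e => hvw (congrArg Subtype.val e))
      · rw [G.adj_comm, Set.pair_comm]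
        exact hadj w v hvw.symm hw
    · exact hadj v w hvw hv

end Substitution

/-! ### Small and single-cycle networks -/

section Base

theorem IsGaTEx.of_iso {V : Type*} {V' : Type*} {G : SimpleGraph V} {G' : SimpleGraph V'}
    (hG : IsGaTEx G) (e : G' ≃g G) : IsGaTEx G' := by
  obtain ⟨W, N, X, t, hN, ht, ⟨f⟩⟩ := hG
  exact ⟨W, N, X, t, hN, ht, ⟨e.trans f⟩⟩

theorem isGaTEx_of_subsingleton {V : Type*} [Nonempty V] [Subsingleton V] (G : SimpleGraph V) :
    IsGaTEx G := by
  refine isGaTEx_iff.2 ⟨Unit, ⟨fun _ _ => False⟩, Set.univ, fun _ => .leaf, fun _ => (),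
    ⟨inferInstance, fun v h => ?_, Or.inl ⟨(), by ext; simp, by ext; simp⟩⟩, by simp [IsLabeling],
    ⟨fun _ _ _ => Subsingleton.elim _ _, by ext; simp,
      fun v w h => absurd (Subsingleton.elim v w) h⟩⟩
  obtain ⟨w, hw, -⟩ := Relation.TransGen.head'_iff.1 h
  exact hw

/-- The network that consists of a root whose children are the elements of `L`. -/
def starNetwork (L : Type*) : Digraph (Option L) where
  Adj
    | none, some _ => True
    | _, _ => False

theorem starNetwork_adj {L : Type*} {u v : Option L} :
    (starNetwork L).Adj u v ↔ u = none ∧ v ≠ none := by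
  rcases u with _ | u <;> rcases v with _ | v <;> simp [starNetwork]

theorem starNetwork_anc {L : Type*} {u v : Option L} :
    IsAncestor (starNetwork L) u v ↔ u = none ∨ u = v := by
  constructor
  · intro h
    rcases Relation.ReflTransGen.cases_head h with h | ⟨c, h, -⟩
    · exact Or.inr h
    · exact Or.inl (starNetwork_adj.1 h).1
  · rintro (rfl | rfl)
    · by_cases hv : v = none
      · rw [hv]; exact .refl
      · exact .single (starNetwork_adj.2 ⟨rfl, hv⟩)
    · exact .refl

theorem starNetwork_acyclic {L : Type*} (v : Option L) :
    ¬ Relation.TransGen (starNetwork L).Adj v v := by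
  intro h
  obtain ⟨w, hw, -⟩ := Relation.TransGen.head'_iff.1 h
  obtain ⟨w', -, hw'⟩ := Relation.TransGen.tail'_iff.1 h
  exact (starNetwork_adj.1 hw').2 (starNetwork_adj.1 hw).1

theorem starNetwork_isNontrivialNetwork {L : Type*} [Finite L] [Nontrivial L] :
    IsNontrivialNetwork (starNetwork L) (Set.range some) := by
  have hin : ∀ x : L, indeg (starNetwork L) (some x) = 1 := fun x => by
    rw [indeg, Set.ncard_eq_one]
    exact ⟨none, by ext; simp [starNetwork_adj]⟩
  have hhyb : ∀ v : Option L, ¬ IsHybrid (starNetwork L) v := by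
    rintro (_ | v) h
    · have : indeg (starNetwork L) (none : Option L) = 0 := by simp [indeg, starNetwork_adj]
      have := h.1
      omega
    · have := h.1
      have := hin v
      omega
  refine ⟨none, ⟨by simp [indeg, starNetwork_adj], ?_, ?_⟩, ?_, ?_, ?_⟩
  · obtain ⟨a, b, hab⟩ := exists_pair_ne L
    rw [outdeg, ← Set.ncard_pair (fun e => hab (Option.some.inj e) : some a ≠ some b)]
    refine Set.ncard_le_ncard ?_
    rintro x (rfl | rfl) <;> simp [starNetwork_adj]
  · rintro (_ | v) hv
    · rfl
    · have := hin v; omega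
  · rintro (_ | v)
    · simp [indeg, starNetwork_adj]
    · simp [hin v, outdeg, starNetwork_adj]
  · rintro (_ | v) h1 h2
    · exact absurd rfl h2
    · exact absurd ⟨v, rfl⟩ h1
  · exact fun C _ h hh => absurd hh.2.1 (hhyb h)

/-- Complete and edgeless graphs are explained by stars. -/
theorem isGaTEx_star {L : Type} [Finite L] [Nontrivial L] (G : SimpleGraph L)
    (h : ∀ x y x' y', x ≠ y → x' ≠ y' → (G.Adj x y ↔ G.Adj x' y')) : IsGaTEx G := by
  classical
  obtain ⟨a, b, hab⟩ := exists_pair_ne L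
  refine isGaTEx_iff.2 ⟨Option L, starNetwork L, Set.range some,
    fun u => u.elim (if G.Adj a b then .one else .zero) fun _ => .leaf, some,
    ⟨inferInstance, starNetwork_acyclic, Or.inr starNetwork_isNontrivialNetwork⟩, ?_,
    ⟨Option.some_injective L, rfl, fun v w hvw => ?_⟩⟩
  · rintro (_ | v)
    · by_cases hG : G.Adj a b <;> simp [hG]
    · simp
  · have hl := isLCA_pair_iff (N := starNetwork L) (x := some v) (y := some w) (l := none)
      starNetwork_acyclic
      (starNetwork_anc.2 (Or.inl rfl)) (starNetwork_anc.2 (Or.inl rfl)) (fun u h1 h2 => ?_)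
    · simp only [hl, exists_eq_left]
      rw [h v w a b hvw hab]
      by_cases hG : G.Adj a b <;> simp [hG]
    · rw [starNetwork_anc] at h1 h2 ⊢
      refine Or.inl (h1.resolve_right ?_)
      rintro rfl
      rcases h2 with h2 | h2
      · cases h2
      · exact hvw (Option.some.inj h2)

variable {n : ℕ} {k : Fin n}

/-- The network with a single cycle: the root `none` starts the two paths `0, 1, …, k` and
`n - 1, n - 2, …, k` of inner vertices `some (inr i)`, which end in the hybrid-vertex
`some (inr k)`, and the leaf `some (inl i)` is attached to the `i`-th inner vertex. -/
def cycleNetwork (k : Fin n) : Digraph (Option (Fin n ⊕ Fin n)) where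
  Adj
    | none, some (.inr i) => (i : ℕ) = 0 ∨ (i : ℕ) + 1 = n
    | some (.inr i), some (.inr j) =>
      ((i : ℕ) + 1 = j ∧ (j : ℕ) ≤ k) ∨ ((j : ℕ) + 1 = i ∧ (k : ℕ) ≤ j)
    | some (.inr i), some (.inl j) => i = j
    | _, _ => False

/-- The ancestor relation of `cycleNetwork k`. -/
def CycleAnc (k : Fin n) : Option (Fin n ⊕ Fin n) → Option (Fin n ⊕ Fin n) → Prop
  | none, _ => True
  | some (.inr i), some (.inr j) => (i ≤ j ∧ j ≤ k) ∨ (j ≤ i ∧ k ≤ j)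
  | some (.inr i), some (.inl j) => (i ≤ j ∧ j ≤ k) ∨ (j ≤ i ∧ k ≤ j) ∨ i = j
  | some (.inl i), some (.inl j) => i = j
  | _, _ => False

theorem cycleNetwork_anc_up {i j : ℕ} (hij : i ≤ j) (hjk : j ≤ k) :
    IsAncestor (cycleNetwork k) (some (.inr ⟨i, by omega⟩)) (some (.inr ⟨j, by omega⟩)) := by
  induction j, hij using Nat.le_induction with
  | base => exact .refl
  | succ j hij ih => exact (ih (by omega)).tail (Or.inl ⟨rfl, hjk⟩)

theorem cycleNetwork_anc_down {j i : ℕ} (hji : j ≤ i) (hi : i < n) (hkj : k ≤ j) :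
    IsAncestor (cycleNetwork k) (some (.inr ⟨i, hi⟩)) (some (.inr ⟨j, by omega⟩)) := by
  induction i, hji using Nat.le_induction with
  | base => exact .refl
  | succ i hij ih =>
    have harc : (cycleNetwork k).Adj (some (.inr ⟨i + 1, hi⟩)) (some (.inr ⟨i, by omega⟩)) :=
      Or.inr ⟨rfl, by simp only; omega⟩
    exact Relation.ReflTransGen.head harc (ih (by omega))

theorem cycleNetwork_anc_inner {i j : Fin n} (h : (i ≤ j ∧ j ≤ k) ∨ (j ≤ i ∧ k ≤ j)) :
    IsAncestor (cycleNetwork k) (some (.inr i)) (some (.inr j)) := by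
  rcases h with h | h
  · exact cycleNetwork_anc_up h.1 h.2
  · exact cycleNetwork_anc_down h.1 i.2 h.2

theorem cycleNetwork_anc_root (v : Option (Fin n ⊕ Fin n)) :
    IsAncestor (cycleNetwork k) none v := by
  have hinner : ∀ i, IsAncestor (cycleNetwork k) none (some (.inr i)) := by
    intro i
    rcases le_total i k with h | h
    · have harc : (cycleNetwork k).Adj none (some (.inr ⟨0, by omega⟩)) := Or.inl rfl
      exact Relation.ReflTransGen.head harc (cycleNetwork_anc_up (Nat.zero_le i) h)
    · have harc : (cycleNetwork k).Adj none (some (.inr ⟨n - 1, by omega⟩)) :=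
        Or.inr (by simp only; omega)
      exact Relation.ReflTransGen.head harc
        (cycleNetwork_anc_down (j := i) (i := n - 1) (by omega) _ h)
  rcases v with _ | i | i
  · exact .refl
  · exact (hinner i).tail rfl
  · exact hinner i

theorem cycleNetwork_anc_iff {u v : Option (Fin n ⊕ Fin n)} :
    IsAncestor (cycleNetwork k) u v ↔ CycleAnc k u v := by
  constructor
  · intro h
    induction h with
    | refl =>
      rcases u with _ | i | i
      · trivial
      · rfl
      · simp only [CycleAnc]; omega
    | @tail c d _ h ih =>
      rcases u with _ | i | i
      · trivial
      · rcases c with _ | c | c <;> rcases d with _ | d | d <;>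
          simp only [CycleAnc, cycleNetwork] at h ih ⊢
      · rcases c with _ | c | c <;> rcases d with _ | d | d <;>
          simp only [CycleAnc, cycleNetwork] at h ih ⊢
        · subst h; omega
        · omega
  · intro h
    rcases u with _ | i | i
    · exact cycleNetwork_anc_root v
    · rcases v with _ | j | j <;> simp only [CycleAnc] at h
      rw [h]
      exact .refl
    · rcases v with _ | j | j <;> simp only [CycleAnc] at h
      · exact (cycleNetwork_anc_inner (j := j) (by omega)).tail rfl
      · exact cycleNetwork_anc_inner h

theorem cycleNetwork_acyclic (v : Option (Fin n ⊕ Fin n)) :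
    ¬ Relation.TransGen (cycleNetwork k).Adj v v := by
  intro hv
  obtain ⟨w, hvw, hwv⟩ := Relation.TransGen.head'_iff.1 hv
  have hwv := cycleNetwork_anc_iff.1 hwv
  rcases v with _ | v | v <;> rcases w with _ | w | w <;>
    simp only [CycleAnc, cycleNetwork] at hvw hwv
  omega

theorem cycleNetwork_isNontrivialNetwork (h0 : 0 < (k : ℕ)) (hn : (k : ℕ) + 1 < n) :
    IsNontrivialNetwork (cycleNetwork k) (Set.range fun i => some (.inl i)) := by
  have hroot : indeg (cycleNetwork k) none = 0 := by
    have : {u | (cycleNetwork k).Adj u none} = ∅ := by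
      ext u
      rcases u with _ | u | u <;> simp [cycleNetwork]
    rw [indeg, this, Set.ncard_empty]
  have hleaf : ∀ i, indeg (cycleNetwork k) (some (.inl i)) = 1 := by
    intro i
    rw [indeg, Set.ncard_eq_one]
    refine ⟨some (.inr i), ?_⟩
    ext u
    rcases u with _ | u | u <;> simp [cycleNetwork]
  have hleaf' : ∀ i, outdeg (cycleNetwork k) (some (.inl i)) = 0 := by
    intro i
    have : {u | (cycleNetwork k).Adj (some (.inl i)) u} = ∅ := by
      ext u
      rcases u with _ | u | u <;> simp [cycleNetwork]
    rw [outdeg, this, Set.ncard_empty]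
  have hinner : ∀ i, i ≠ k → indeg (cycleNetwork k) (some (.inr i)) = 1 := by
    intro i hik
    rw [indeg, Set.ncard_eq_one]
    have hik' : (i : ℕ) ≠ k := fun e => hik (Fin.ext e)
    by_cases hi0 : (i : ℕ) = 0 ∨ (i : ℕ) + 1 = n
    · refine ⟨none, ?_⟩
      ext u
      rcases u with _ | u | u <;> simp [cycleNetwork] <;> omega
    · by_cases hik2 : (i : ℕ) < k
      · refine ⟨some (.inr ⟨i - 1, by omega⟩), ?_⟩
        ext u
        rcases u with _ | u | u <;> simp [cycleNetwork, Fin.ext_iff] <;> omega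
      · refine ⟨some (.inr ⟨i + 1, by omega⟩), ?_⟩
        ext u
        rcases u with _ | u | u <;> simp [cycleNetwork, Fin.ext_iff] <;> omega
  have hhyb : indeg (cycleNetwork k) (some (.inr k)) = 2 := by
    rw [indeg, Set.ncard_eq_two]
    refine ⟨some (.inr ⟨k - 1, by omega⟩), some (.inr ⟨k + 1, by omega⟩), ?_, ?_⟩
    · simp [Fin.ext_iff]
    · ext u
      rcases u with _ | u | u <;> simp [cycleNetwork, Fin.ext_iff] <;> omega
  have hout : ∀ u a b, a ≠ b → (cycleNetwork k).Adj u a → (cycleNetwork k).Adj u b →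
      2 ≤ outdeg (cycleNetwork k) u := by
    intro u a b hab ha hb
    rw [outdeg, ← Set.ncard_pair hab]
    refine Set.ncard_le_ncard ?_
    rintro x (rfl | rfl)
    · exact ha
    · exact hb
  refine ⟨none, ⟨hroot, ?_, ?_⟩, ?_, ?_, ?_⟩
  · refine hout none (some (.inr ⟨0, by omega⟩)) (some (.inr ⟨n - 1, by omega⟩)) ?_ (Or.inl rfl)
      (Or.inr (by simp only; omega))
    simp [Fin.ext_iff]
    omega
  · rintro (_ | i | i) hi
    · rfl
    · have := hleaf i; omega
    · by_cases hik : i = k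
      · subst hik; omega
      · have := hinner i hik; omega
  · rintro (_ | i | i)
    · simp [hroot]
    · simp [hleaf i, hleaf' i]
    · have : outdeg (cycleNetwork k) (some (.inr i)) ≠ 0 := by
        rw [outdeg, Ne, Set.ncard_eq_zero]
        exact fun h => h.subset (show some (.inl i) ∈ _ from rfl)
      simp [this]
  · rintro (_ | i | i) h1 h2
    · exact absurd rfl h2
    · exact absurd ⟨i, rfl⟩ h1
    · by_cases hik : i = k
      · subst hik
        refine Or.inr ⟨hhyb, Nat.one_le_iff_ne_zero.2 ?_⟩
        rw [outdeg, Ne, Set.ncard_eq_zero]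
        exact fun h => h.subset (show some (.inl i) ∈ _ from rfl)
      · refine Or.inl ⟨hinner i hik, ?_⟩
        have hik' : (i : ℕ) ≠ k := fun e => hik (Fin.ext e)
        by_cases hik2 : (i : ℕ) < k
        · exact hout _ (some (.inl i)) (some (.inr ⟨i + 1, by omega⟩)) (by simp) rfl
            (Or.inl ⟨rfl, by simp only; omega⟩)
        · exact hout _ (some (.inl i)) (some (.inr ⟨i - 1, by omega⟩)) (by simp) rfl
            (Or.inr ⟨by simp only; omega, by simp only; omega⟩)
  · have huniq : ∀ v, IsHybrid (cycleNetwork k) v → v = some (.inr k) := by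
      rintro (_ | i | i) ⟨h, -⟩
      · omega
      · have := hleaf i; omega
      · by_contra hik
        have := hinner i (fun e => hik (by rw [e]))
        omega
    exact fun C _ h hh h' hh' => (huniq h hh.2.1).trans (huniq h' hh'.2.1).symm

/-- A graph on an initial segment of the naturals, in which the adjacency of `i` and `j` depends
only on the smaller one if both are at most `k`, only on the larger one if both are at least `k`,
and is constant if `k` is strictly between them, is explained by a network with one cycle. -/
theorem isGaTEx_fin (G : SimpleGraph (Fin n)) (h0 : 0 < (k : ℕ)) (hn : (k : ℕ) + 1 < n)
    (hl : ∀ i j j', i < j → j ≤ k → i < j' → j' ≤ k → (G.Adj i j ↔ G.Adj i j'))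
    (hr : ∀ i j j', j < i → k ≤ j → j' < i → k ≤ j' → (G.Adj i j ↔ G.Adj i j'))
    (hc : ∀ i j i' j', i < k → k < j → i' < k → k < j' → (G.Adj i j ↔ G.Adj i' j')) :
    IsGaTEx G := by
  classical
  let a : Fin n := ⟨0, by omega⟩
  let b : Fin n := ⟨n - 1, by omega⟩
  have hak : a < k := h0
  have hkb : k < b := by show (k : ℕ) < n - 1; omega
  let t : Option (Fin n ⊕ Fin n) → Label := fun u => u.elim (if G.Adj a b then .one else .zero)
    (Sum.elim (fun _ => .leaf) fun i => if G.Adj i k then .one else .zero)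
  have htinner : ∀ i, t (some (.inr i)) = .one ↔ G.Adj i k := by
    intro i
    by_cases h : G.Adj i k <;> simp [t, h]
  have htroot : t none = .one ↔ G.Adj a b := by
    by_cases h : G.Adj a b <;> simp [t, h]
  have hanc : ∀ {u v}, IsAncestor (cycleNetwork k) u v ↔ CycleAnc k u v := cycleNetwork_anc_iff
  have hlt : ∀ i j, i < j → (G.Adj i j ↔ ∃ u, IsLCA (cycleNetwork k)
      {some (.inl i), some (.inl j)} u ∧ t u = .one) := by
    intro i j hij
    -- the lowest common ancestor is the upper one of two vertices on the same side of the cycle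
    -- and the root for vertices on different sides
    rcases le_or_gt j k with hjk | hjk
    · have hL := isLCA_pair_iff (N := cycleNetwork k) (x := some (.inl i)) (y := some (.inl j))
        (l := some (.inr i)) cycleNetwork_acyclic (hanc.2 (by simp only [CycleAnc]; omega))
        (hanc.2 (by simp only [CycleAnc]; omega)) fun w h1 h2 => by
          rw [hanc] at h1 h2 ⊢
          rcases w with _ | w | w <;> simp only [CycleAnc] at h1 h2 ⊢ <;> omega
      simp only [hL, exists_eq_left]
      rw [htinner]
      exact hl i j k hij hjk (hij.trans_le hjk) le_rfl
    · rcases le_or_gt k i with hki | hki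
      · have hL := isLCA_pair_iff (N := cycleNetwork k) (x := some (.inl i)) (y := some (.inl j))
          (l := some (.inr j)) cycleNetwork_acyclic (hanc.2 (by simp only [CycleAnc]; omega))
          (hanc.2 (by simp only [CycleAnc]; omega)) fun w h1 h2 => by
            rw [hanc] at h1 h2 ⊢
            rcases w with _ | w | w <;> simp only [CycleAnc] at h1 h2 ⊢ <;> omega
        simp only [hL, exists_eq_left]
        rw [htinner, G.adj_comm]
        exact hr j i k hij hki hjk le_rfl
      · have hL := isLCA_pair_iff (N := cycleNetwork k) (x := some (.inl i)) (y := some (.inl j))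
          (l := none) cycleNetwork_acyclic (hanc.2 trivial) (hanc.2 trivial) fun w h1 h2 => by
            rw [hanc] at h1 h2 ⊢
            rcases w with _ | w | w <;> simp only [CycleAnc] at h1 h2 ⊢ <;> omega
        simp only [hL, exists_eq_left]
        rw [htroot]
        exact hc i j a b hki hjk hak hkb
  refine isGaTEx_iff.2 ⟨_, cycleNetwork k, Set.range fun i => some (.inl i), t,
    fun i => some (.inl i), ⟨inferInstance, cycleNetwork_acyclic,
      Or.inr (cycleNetwork_isNontrivialNetwork h0 hn)⟩, ?_, ?_, rfl, ?_⟩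
  · rintro (_ | i | i)
    · by_cases h : G.Adj a b <;> simp [t, h]
    · simp [t]
    · by_cases h : G.Adj i k <;> simp [t, h]
  · intro i j hij
    simpa using hij
  · intro i j hij
    rcases lt_or_gt_of_ne hij with h | h
    · exact hlt i j h
    · rw [G.adj_comm, Set.pair_comm]
      exact hlt j i h

end Base

/-! ### Primitive pseudo-cographs -/

section Primitive

variable {V : Type u} {G : SimpleGraph V}

/-- Every module of `G[Y]` that avoids `v` is a singleton. -/
def NoModuleAvoiding (G : SimpleGraph V) (Y : Set V) (v : V) : Prop :=
  ∀ M ⊆ Y, v ∉ M → M.Nonempty → (∀ x ∈ M, ∀ y ∈ M, ∀ z ∈ Y, z ∉ M → G.Adj x z → G.Adj y z) →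
    ∃ x, M = {x}

/-- `r` orders `Y` starting with `v` such that each vertex of `Y` is adjacent to all or to none of
its predecessors. -/
def IsRanking (G : SimpleGraph V) (Y : Set V) (v : V) (r : V → ℕ) : Prop :=
  Set.InjOn r Y ∧ r v = 0 ∧ ∀ b ∈ Y, ∀ x ∈ Y, ∀ x' ∈ Y, r x < r b → r x' < r b →
    (G.Adj b x ↔ G.Adj b x')

/-- The inductive step along the cotree: the part `B` that hangs off the path to `v` is a module, so
it is a single vertex, which is appended to the ranking of `A`. -/
theorem exists_isRanking_union [Finite V] {A B : Set V} {v : V} (hv : v ∈ A) (hdisj : Disjoint A B)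
    (hB : B.Nonempty)
    (h : ∀ a ∈ A, ∀ b ∈ B, ∀ a' ∈ A, ∀ b' ∈ B, (G.Adj b a ↔ G.Adj b' a'))
    (hmod : NoModuleAvoiding G (A ∪ B) v)
    (ih : NoModuleAvoiding G A v → ∃ r, IsRanking G A v r) :
    ∃ r, IsRanking G (A ∪ B) v r := by
  classical
  obtain ⟨b, rfl⟩ : ∃ b, B = {b} := by
    refine hmod B Set.subset_union_right (Set.disjoint_left.1 hdisj hv) hB ?_
    rintro x hx y hy z (hz | hz) hzB hxz
    · exact (h z hz x hx z hz y hy).1 hxz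
    · exact absurd hz hzB
  have hbA : b ∉ A := fun hb => Set.disjoint_left.1 hdisj hb rfl
  obtain ⟨r, hinj, hrv, hr⟩ := ih fun M hM hvM hne hMm => by
    refine hmod M (hM.trans Set.subset_union_left) hvM hne ?_
    rintro x hx y hy z (hz | hz) hzM hxz
    · exact hMm x hx y hy z hz hzM hxz
    · exact ((h y (hM hy) z hz x (hM hx) z hz).2 hxz.symm).symm
  obtain ⟨K, hK⟩ := (Set.toFinite (r '' A)).bddAbove
  have hK : ∀ x ∈ A, r x < K + 1 := fun x hx => Nat.lt_succ_of_le (hK ⟨x, hx, rfl⟩)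
  have hne : ∀ x ∈ A, x ≠ b := fun x hx e => hbA (e ▸ hx)
  have hA : ∀ x ∈ A, Function.update r b (K + 1) x = r x := fun x hx =>
    Function.update_of_ne (hne x hx) _ _
  have hb : Function.update r b (K + 1) b = K + 1 := Function.update_self _ _ _
  refine ⟨Function.update r b (K + 1), ?_, by rw [hA v hv, hrv], ?_⟩
  · rintro x (hx | rfl) y (hy | rfl) hxy
    · rw [hA x hx, hA y hy] at hxy
      exact hinj hx hy hxy
    · rw [hA x hx, hb] at hxy
      exact absurd hxy (hK x hx).ne
    · rw [hA y hy, hb] at hxy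
      exact absurd hxy (hK y hy).ne'
    · rfl
  · rintro c (hc | rfl) x (hx | rfl) y (hy | rfl) h1 h2
    · rw [hA _ hc, hA _ hx] at h1
      rw [hA _ hc, hA _ hy] at h2
      exact hr c hc x hx y hy h1 h2
    · rw [hA _ hc, hb] at h2
      exact absurd h2 (hK c hc).not_gt
    · rw [hA _ hc, hb] at h1
      exact absurd h1 (hK c hc).not_gt
    · rfl
    · exact h x hx c rfl y hy c rfl
    · exact absurd h2 (lt_irrefl _)
    · exact absurd h1 (lt_irrefl _)
    · rfl

theorem InducesCograph.nonempty {A : Set V} (hA : InducesCograph G A) : A.Nonempty := by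
  induction hA with
  | single v => exact ⟨v, rfl⟩
  | union A B _ _ _ _ ihA _ => exact ihA.mono Set.subset_union_left
  | join A B _ _ _ _ ihA _ => exact ihA.mono Set.subset_union_left

/-- A cograph without modules avoiding `v` is built from `v` by successively adding isolated and
universal vertices: the subgraphs hanging off the path from the root of the cotree to `v` are
modules. -/
theorem InducesCograph.exists_isRanking [Finite V] {Y : Set V} (hY : InducesCograph G Y) :
    ∀ v ∈ Y, NoModuleAvoiding G Y v → ∃ r, IsRanking G Y v r := by
  induction hY with
  | single w =>
    rintro v rfl -
    refine ⟨fun _ => 0, Set.injOn_singleton _ _, rfl, fun _ _ _ _ _ _ h => absurd h (lt_irrefl _)⟩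
  | union A B hA hB hdisj h ihA ihB =>
    rintro v (hv | hv) hmod
    · refine exists_isRanking_union hv hdisj hB.nonempty ?_ hmod (ihA v hv)
      exact fun a ha b hb a' ha' b' hb' => iff_of_false (fun e => h a ha b hb e.symm)
        (fun e => h a' ha' b' hb' e.symm)
    · rw [Set.union_comm] at hmod ⊢
      refine exists_isRanking_union hv hdisj.symm hA.nonempty ?_ hmod (ihB v hv)
      exact fun a ha b hb a' ha' b' hb' => iff_of_false (h b hb a ha) (h b' hb' a' ha')
  | join A B hA hB hdisj h ihA ihB =>
    rintro v (hv | hv) hmod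
    · refine exists_isRanking_union hv hdisj hB.nonempty ?_ hmod (ihA v hv)
      exact fun a ha b hb a' ha' b' hb' => iff_of_true (h a ha b hb).symm (h a' ha' b' hb').symm
    · rw [Set.union_comm] at hmod ⊢
      refine exists_isRanking_union hv hdisj.symm hA.nonempty ?_ hmod (ihB v hv)
      exact fun a ha b hb a' ha' b' hb' => iff_of_true (h b hb a ha) (h b' hb' a' ha')

theorem IsPseudoCographFor.swap {v : V} {Y Z : Set V} (h : IsPseudoCographFor G v Y Z) :
    IsPseudoCographFor G v Z Y where
  union_eq := by rw [Set.union_comm]; exact h.union_eq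
  inter_eq := by rw [Set.inter_comm]; exact h.inter_eq
  one_lt_left := h.one_lt_right
  one_lt_right := h.one_lt_left
  cograph_left := h.cograph_right
  cograph_right := h.cograph_left
  join_or_union := h.join_or_union.imp (fun h y hy z hz => (h z hz y hy).symm)
    (fun h y hy z hz e => h z hz y hy e.symm)

theorem IsPseudoCographFor.adj_iff {v : V} {Y Z : Set V} (h : IsPseudoCographFor G v Y Z)
    {y z y' z' : V} (hy : y ∈ Y \ {v}) (hz : z ∈ Z \ {v}) (hy' : y' ∈ Y \ {v})
    (hz' : z' ∈ Z \ {v}) : G.Adj y z ↔ G.Adj y' z' := by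
  rcases h.join_or_union with h | h
  · exact iff_of_true (h y hy z hz) (h y' hy' z' hz')
  · exact iff_of_false (h y hy z hz) (h y' hy' z' hz')

theorem IsPseudoCographFor.mem_left {v : V} {Y Z : Set V} (h : IsPseudoCographFor G v Y Z) :
    v ∈ Y := (h.inter_eq.symm.subset rfl).1

theorem IsPseudoCographFor.exists_isRanking [Finite V] {v : V} {Y Z : Set V}
    (h : IsPseudoCographFor G v Y Z) (hG : IsPrimitive G) : ∃ r, IsRanking G Y v r := by
  refine h.cograph_left.exists_isRanking v h.mem_left fun M hM hvM hne hMm => ?_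
  refine (hG.2 M hne (isModule_of_adj fun x hx y hy z hz hxz => ?_)).resolve_right
    fun e => hvM (e ▸ Set.mem_univ v)
  by_cases hzY : z ∈ Y
  · exact hMm x hx y hy z hzY hz hxz
  · have hzZ : z ∈ Z := (h.union_eq.symm.subset (Set.mem_univ z)).resolve_left hzY
    have hzv : z ∉ ({v} : Set V) := fun e => hzY (h.inter_eq.symm.subset e).1
    exact (h.adj_iff ⟨hM hx, fun e => hvM (e ▸ hx)⟩ ⟨hzZ, hzv⟩ ⟨hM hy, fun e => hvM (e ▸ hy)⟩
      ⟨hzZ, hzv⟩).1 hxz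

/-- A primitive pseudo-cograph is explained by a network with a single cycle. -/
theorem IsPseudoCographFor.isGaTEx [Finite V] {v : V} {Y Z : Set V}
    (h : IsPseudoCographFor G v Y Z) (hG : IsPrimitive G) : IsGaTEx G := by
  classical
  obtain ⟨r, hrinj, hrv, hr⟩ := h.exists_isRanking hG
  obtain ⟨s, hsinj, hsv, hs⟩ := h.swap.exists_isRanking hG
  have hYZ : ∀ x, x ∈ Y ∨ x ∈ Z := fun x => h.union_eq.symm.subset (Set.mem_univ x)
  have hint : ∀ x, x ∈ Y → x ∈ Z → x = v := fun x hx hx' => h.inter_eq.subset ⟨hx, hx'⟩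
  have hvY := h.mem_left
  have hvZ := h.swap.mem_left
  -- the positions on the cycle: `Y` in decreasing rank, then `v`, then `Z` in increasing rank
  let p : V → ℤ := fun x => if x ∈ Y then -(r x : ℤ) else s x
  have hpY : ∀ x ∈ Y, p x = -(r x : ℤ) := fun x hx => if_pos hx
  have hpv : p v = 0 := by rw [hpY v hvY, hrv]; simp
  have hpZ : ∀ x ∈ Z, p x = s x := by
    intro x hx
    by_cases hxY : x ∈ Y
    · rw [hint x hxY hx, hpv, hsv]; simp
    · exact if_neg hxY
  have hY0 : ∀ x ∈ Y, x ≠ v → p x < 0 := by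
    intro x hx hxv
    have : r x ≠ r v := fun e => hxv (hrinj hx hvY e)
    rw [hpY x hx]; omega
  have hZ0 : ∀ x ∈ Z, x ≠ v → 0 < p x := by
    intro x hx hxv
    have : s x ≠ s v := fun e => hxv (hsinj hx hvZ e)
    rw [hpZ x hx]; omega
  have hmY : ∀ x, p x ≤ 0 → x ∈ Y := by
    intro x hx
    by_contra hxY
    exact (hZ0 x ((hYZ x).resolve_left hxY) fun e => hxY (e ▸ hvY)).not_ge hx
  have hmZ : ∀ x, 0 ≤ p x → x ∈ Z := by
    intro x hx
    by_contra hxZ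
    exact (hY0 x ((hYZ x).resolve_right hxZ) fun e => hxZ (e ▸ hvZ)).not_ge hx
  have hpinj : Function.Injective p := by
    intro x y hxy
    rcases le_total (p x) 0 with hx | hx
    · have hxY := hmY x hx
      have hyY := hmY y (hxy ▸ hx)
      rw [hpY x hxY, hpY y hyY] at hxy
      exact hrinj hxY hyY (by omega)
    · have hxZ := hmZ x hx
      have hyZ := hmZ y (hxy ▸ hx)
      rw [hpZ x hxZ, hpZ y hyZ] at hxy
      exact hsinj hxZ hyZ (by omega)
  have hlt0 : ∀ x, p x < 0 → x ∈ Y \ {v} := fun x hx =>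
    ⟨hmY x hx.le, fun e => by rw [show x = v from e, hpv] at hx; exact lt_irrefl _ hx⟩
  have hgt0 : ∀ x, 0 < p x → x ∈ Z \ {v} := fun x hx =>
    ⟨hmZ x hx.le, fun e => by rw [show x = v from e, hpv] at hx; exact lt_irrefl _ hx⟩
  have := Fintype.ofFinite V
  let _ : LinearOrder V := LinearOrder.lift' p hpinj
  have hplt : ∀ {x y : V}, x < y ↔ p x < p y := Iff.rfl
  have hple : ∀ {x y : V}, x ≤ y ↔ p x ≤ p y := Iff.rfl
  let e : Fin (Fintype.card V) ≃o V := Fintype.orderIsoFinOfCardEq V rfl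
  have hlt : ∀ {i j}, i < j ↔ p (e i) < p (e j) := fun {i j} => e.lt_iff_lt.symm.trans hplt
  have hle : ∀ {i j}, i ≤ j ↔ p (e i) ≤ p (e j) := fun {i j} => e.le_iff_le.symm.trans hple
  have hpk : p (e (e.symm v)) = 0 := by rw [e.apply_symm_apply, hpv]
  obtain ⟨y, hyY, hyv⟩ := Set.exists_ne_of_one_lt_ncard h.one_lt_left v
  obtain ⟨z, hzZ, hzv⟩ := Set.exists_ne_of_one_lt_ncard h.one_lt_right v
  have hy : e.symm y < e.symm v := e.symm.lt_iff_lt.2 (hplt.2 (by rw [hpv]; exact hY0 y hyY hyv))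
  have hz : e.symm v < e.symm z := e.symm.lt_iff_lt.2 (hplt.2 (by rw [hpv]; exact hZ0 z hzZ hzv))
  have hfin : IsGaTEx (G.comap e.toEquiv) := by
    refine isGaTEx_fin (k := e.symm v) _ (by omega) (by omega) ?_ ?_ ?_
    · intro i j j' hij hj hij' hj'
      rw [hle, hpk] at hj hj'
      rw [hlt] at hij hij'
      have hi := hmY _ (hij.le.trans hj)
      have h1 := hmY _ hj
      have h2 := hmY _ hj'
      rw [hpY _ hi, hpY _ h1] at hij
      rw [hpY _ hi, hpY _ h2] at hij'
      have c1 : r (e j) < r (e i) := by omega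
      have c2 : r (e j') < r (e i) := by omega
      exact hr _ hi _ h1 _ h2 c1 c2
    · intro i j j' hij hj hij' hj'
      rw [hle, hpk] at hj hj'
      rw [hlt] at hij hij'
      have hi := hmZ _ (hj.trans hij.le)
      have h1 := hmZ _ hj
      have h2 := hmZ _ hj'
      rw [hpZ _ hi, hpZ _ h1] at hij
      rw [hpZ _ hi, hpZ _ h2] at hij'
      have c1 : s (e j) < s (e i) := by omega
      have c2 : s (e j') < s (e i) := by omega
      exact hs _ hi _ h1 _ h2 c1 c2
    · intro i j i' j' hi hj hi' hj'
      rw [hlt, hpk] at hi hj hi' hj'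
      exact h.adj_iff (hlt0 _ hi) (hgt0 _ hj) (hlt0 _ hi') (hgt0 _ hj')
  exact hfin.of_iso (SimpleGraph.Iso.comap e.toEquiv G).symm

end Primitive

/-! ### Modular decomposition -/

section Decomposition

variable {V : Type u} {G : SimpleGraph V}

/-- A graph on three vertices `a`, `b`, `c` has a module with two elements, since two of its three
pairs of vertices have the same adjacency. -/
theorem exists_isModule_of_card_eq_three [Finite V] (G : SimpleGraph V) (h : Nat.card V = 3) :
    ∃ M : Set V, IsModule G M ∧ ∃ m ∈ M, ∃ m' ∈ M, m ≠ m' ∧ ∃ v, v ∉ M := by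
  rw [← Set.ncard_univ, Set.ncard_eq_three] at h
  obtain ⟨a, b, c, hab, hac, hbc, huniv⟩ := h
  have key : ∀ a b c : V, a ≠ b → a ≠ c → b ≠ c → (∀ x, x = a ∨ x = b ∨ x = c) →
      (G.Adj a c ↔ G.Adj b c) →
      ∃ M : Set V, IsModule G M ∧ ∃ m ∈ M, ∃ m' ∈ M, m ≠ m' ∧ ∃ v, v ∉ M := by
    intro a b c hab hac hbc hall hadj
    refine ⟨{a, b}, isModule_of_adj ?_, a, by simp, b, by simp, hab, c, by
      simp [hac.symm, hbc.symm]⟩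
    rintro x hx y hy z hz
    obtain rfl : z = c := by
      rcases hall z with e | e | e
      · exact absurd (Or.inl e) hz
      · exact absurd (Or.inr e) hz
      · exact e
    rcases hx with rfl | rfl <;> rcases hy with rfl | rfl <;> simp [hadj]
  have hall : ∀ x, x = a ∨ x = b ∨ x = c := fun x => by
    have := huniv.subset (Set.mem_univ x)
    simpa using this
  by_cases h1 : G.Adj a c ↔ G.Adj b c
  · exact key a b c hab hac hbc hall h1
  by_cases h2 : G.Adj a b ↔ G.Adj c b
  · exact key a c b hac hab hbc.symm (fun x => by have := hall x; tauto) h2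
  refine key b c a hbc hab.symm hac.symm (fun x => by have := hall x; tauto) ?_
  rw [G.adj_comm b a, G.adj_comm c a]
  rw [G.adj_comm c b] at h2
  tauto

/-- The case of a graph without nontrivial modules: it has at most two vertices or is
primitive. -/
theorem isGaTEx_of_forall_isModule [Finite V] [Nonempty V]
    (hG : IsPrimitive G → IsPseudoCograph G)
    (h : ∀ M : Set V, IsModule G M → ∀ m ∈ M, ∀ m' ∈ M, m ≠ m' → ∀ v, v ∈ M) : IsGaTEx G := by
  rcases Nat.lt_or_ge (Nat.card V) 4 with h4 | h4
  · have hpos : 0 < Nat.card V := Nat.card_pos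
    have h3 : Nat.card V ≠ 3 := fun h3 => by
      obtain ⟨M, hM, m, hm, m', hm', hne, v, hv⟩ := exists_isModule_of_card_eq_three G h3
      exact hv (h M hM m hm m' hm' hne v)
    rcases Nat.lt_or_ge (Nat.card V) 2 with h2 | h2
    · have := Finite.card_le_one_iff_subsingleton.1 (Nat.le_of_lt_succ h2)
      exact isGaTEx_of_subsingleton G
    · have e : Fin 2 ≃ V := (Finite.equivFinOfCardEq (by omega)).symm
      refine IsGaTEx.of_iso (G := G.comap e) (isGaTEx_star _ ?_)
        (SimpleGraph.Iso.comap e G).symm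
      intro x y x' y' hxy hxy'
      obtain ⟨rfl, rfl⟩ | ⟨rfl, rfl⟩ : x = x' ∧ y = y' ∨ x = y' ∧ y = x' := by omega
      · rfl
      · exact SimpleGraph.adj_comm _ _ _
  · have hprim : IsPrimitive G := by
      refine ⟨h4, fun M ⟨m, hm⟩ hM => ?_⟩
      by_cases hex : ∃ m' ∈ M, m ≠ m'
      · obtain ⟨m', hm', hne⟩ := hex
        exact Or.inr (Set.eq_univ_of_forall (h M hM m hm m' hm' hne))
      · push Not at hex
        exact Or.inl ⟨m, Set.eq_singleton_iff_unique_mem.2 ⟨hm, fun x hx => (hex x hx).symm⟩⟩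
    obtain h2 | ⟨v, Y, Z, hvYZ⟩ := hG hprim
    · omega
    · exact hvYZ.isGaTEx hprim

/-- An induced subgraph of `G[S]` is an induced subgraph of `G`. -/
noncomputable def induceInduceIso (G : SimpleGraph V) (S : Set V) (M : Set S) :
    (G.induce S).induce M ≃g G.induce (Subtype.val '' M) where
  toEquiv := Equiv.ofBijective (fun x => ⟨x.1.1, x.1, x.2, rfl⟩)
    ⟨fun x y h => Subtype.ext (Subtype.ext (show x.1.1 = y.1.1 from Subtype.mk.inj h)),
      fun ⟨_, x, hx, hxy⟩ => ⟨⟨x, hx⟩, Subtype.ext hxy⟩⟩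
  map_rel_iff' := Iff.rfl

/-- Induction on the vertex set: a nontrivial module splits the graph into two smaller induced
subgraphs. -/
theorem isGaTEx_induce [Finite V]
    (hG : ∀ S : Set V, IsPrimitive (G.induce S) → IsPseudoCograph (G.induce S)) (n : ℕ) :
    ∀ S : Set V, S.ncard = n → S.Nonempty → IsGaTEx (G.induce S) := by
  induction n using Nat.strong_induction_on with
  | _ n ih =>
  rintro S rfl hS
  have := hS.to_subtype
  by_cases h : ∀ M : Set S, IsModule (G.induce S) M → ∀ m ∈ M, ∀ m' ∈ M, m ≠ m' → ∀ v, v ∈ M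
  · exact isGaTEx_of_forall_isModule (hG S) h
  push Not at h
  obtain ⟨M, hM, m, hm, m', hm', hne, v, hv⟩ := h
  have aux : ∀ M : Set S, ∀ m ∈ M, ∀ v ∉ M, IsGaTEx ((G.induce S).induce M) := by
    intro M m hm v hv
    refine (ih _ ?_ (Subtype.val '' M) rfl ⟨m, m, hm, rfl⟩).of_iso (induceInduceIso G S M)
    refine Set.ncard_lt_ncard ⟨?_, fun hsub => ?_⟩
    · rintro _ ⟨x, -, rfl⟩
      exact x.2
    · obtain ⟨x, hx, hxv⟩ := hsub v.2
      exact hv (Subtype.ext hxv ▸ hx)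
  refine isGaTEx_of_isModule hM hm hm' hne hv (aux _ m (Or.inr rfl) m' ?_) (aux M m hm v hv)
  rintro (h | h)
  · exact h hm'
  · exact hne h.symm

end Decomposition

end Gatex

theorem mainTheorem2 {V : Type*} [Finite V] [Nonempty V] (G : SimpleGraph V) :
    Gatex.IsGaTEx G ↔
      ∀ W : Set V, Gatex.IsPrimitive (G.induce W) → Gatex.IsPseudoCograph (G.induce W) := by
  refine ⟨fun h W hW => h.isPseudoCograph W hW, fun h => ?_⟩
  exact (Gatex.isGaTEx_induce h _ Set.univ rfl Set.univ_nonempty).of_iso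
    (SimpleGraph.induceUnivIso G).symm
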